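/- Let $X_1,X_2,\dots$ be i.i.d. observations with law $\mu$, let $g(x,\theta)\in\mathbb R^m$, $\theta\in\mathbb R^p$, be a measurable moment function, and write $G(x,\theta)=\partial g(x,\theta)/\partial\theta'$, $F(x,\theta)=\partial\,\mathrm{vec}[G(x,\theta)']/\partial\theta'$, $\psi(x,\theta)=(g(x,\theta)',\ \mathrm{vec}[G(x,\theta)']')'\in\mathbb R^{m(p+1)}$, $g(\theta)=E[g(X,\theta)]$, $G(\theta)=E[G(X,\theta)]$, $\Gamma(\theta)=E[\partial\psi(X,\theta)/\partial\theta']$, $\Sigma(\theta)=E[\psi(X,\theta)\psi(X,\theta)']-E[\psi(X,\theta)]E[\psi(X,\theta)]'$, and $A(W,\theta)=[\,G(\theta)'W\quad g(\theta)'W\otimes I_p\,]$. Let $W$ be a positive definite $m\times m$ matrix and $\Theta\subset\mathbb R^p$ a compact parameter space. Assume: 1. $g(\theta)'Wg(\theta)$ has a unique minimizer $\theta_W$ over $\Theta$ (the GMM pseudo-true value), and $\theta_W$ is in the interior of $\Theta$; 2. with probability one, $g(X,\cdot)$ is twice continuously differentiable in a neighbourhood of each point of $\Theta$; 3. $E[\sup_{\theta\in\Theta}\|g(X,\theta)\|]$,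 $E[\sup_{\theta\in\Theta}\|G(X,\theta)\|]$ and $E[\sup_{\theta\in\Theta}\|F(X,\theta)\|]$ are finite, where $\|\cdot\|$ is the spectral norm for matrices; 4. $E[\|g(X,\theta_W)\|^2]<\infty$ and $E[\|G(X,\theta_W)\|^2]<\infty$. (The moment condition may be misspecified: $g(\theta)=0$ need not have a solution.) For a $p\times m(p+1)$ matrix $\Lambda$ with $\Lambda\Gamma(\theta_W)$ nonsingular, put $$V_M(\Lambda,\theta_W)=(\Lambda\Gamma(\theta_W))^{-1}\Lambda\,\Sigma(\theta_W)\,\Lambda'\,((\Lambda\Gamma(\theta_W))')^{-1}.$$ (a) Let $\Lambda$ be such that $\Lambda\Gamma(\theta_W)$ is nonsingular and $\Lambda\big(E[\psi(X,\theta)]-E[\psi(X,\theta_W)]\big)\ne 0$ for all $\theta\in\Theta$ with $\theta\neq\theta_W$. Let $\widetilde\theta(\Lambda)$ be any (measurable) Z-estimator that, with probability tending to one, lies in $\Theta$ and solves $\Lambda\,\frac1n\sum_{i=1}^n\big(\psi(X_i,\theta)-E[\psi(X,\theta_W)]\big)=0$. Then $$\sqrt n\,(\widetilde\theta(\Lambda)-\theta_W)=-(\Lambda\Gamma(\theta_W))^{-1}\Lambda\,\frac1{\sqrt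 n}\sum_{i=1}^n\big(\psi(X_i,\theta_W)-E[\psi(X,\theta_W)]\big)+o_p(1)$$ and $\sqrt n\,(\widetilde\theta(\Lambda)-\theta_W)\xrightarrow{d}N(0,V_M(\Lambda,\theta_W))$. (b) If $A(W,\theta_W)\Gamma(\theta_W)$ is nonsingular, the standard GMM estimator is asymptotically the special case $\Lambda=A(W,\theta_W)$: any (measurable) $\widehat\theta_{GMM}(W)$ that, with probability tending to one, minimizes $g_n(\theta)'Wg_n(\theta)$ over $\Theta$, where $g_n(\theta)=\frac1n\sum_{i=1}^n g(X_i,\theta)$, has the influence function representation and the limit distribution of (a) with $\Lambda=A(W,\theta_W)$, so that $\sqrt n\,(\widehat\theta_{GMM}(W)-\theta_W)\xrightarrow{d}N(0,V_M(A(W,\theta_W),\theta_W))$. -/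

import Mathlib

open MeasureTheory ProbabilityTheory Filter Topology
open scoped Matrix Kronecker Matrix.Norms.L2Operator

noncomputable section

namespace AugmentedGMM

variable {𝓧 Ω : Type*} {m p : ℕ}

/-- Index set of the augmented moments: the `m` moments, followed by the `m * p` entries of the
Jacobian (the pair `(i, j)` is the position of `∂gᵢ/∂θⱼ` in `vec[G']`). -/
abbrev AugIdx (m p : ℕ) : Type := Fin m ⊕ (Fin m × Fin p)

/-- The matrix `∂f(θ)/∂θ'` of partial derivatives of `f : ℝ^p → ℝ^κ` at `θ`. -/
def jacobian {κ : Type*} [Fintype κ]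
    (f : EuclideanSpace ℝ (Fin p) → EuclideanSpace ℝ κ) (θ : EuclideanSpace ℝ (Fin p)) :
    Matrix κ (Fin p) ℝ :=
  Matrix.of fun i j => fderiv ℝ f θ (EuclideanSpace.single j 1) i

/-- A matrix acting on Euclidean column vectors. -/
def apply {κ ι : Type*} [Fintype κ] [Fintype ι] (M : Matrix κ ι ℝ) (v : EuclideanSpace ℝ ι) :
    EuclideanSpace ℝ κ :=
  WithLp.toLp 2 (M *ᵥ v.ofLp)

/-- The quadratic form `v' W v`. -/
def quadForm (W : Matrix (Fin m) (Fin m) ℝ) (v : EuclideanSpace ℝ (Fin m)) : ℝ :=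
  v.ofLp ⬝ᵥ (W *ᵥ v.ofLp)

section Moments

/- `g x θ` is the vector of moment functions at the observation `x` and the parameter `θ`. -/
variable (g : 𝓧 → EuclideanSpace ℝ (Fin p) → EuclideanSpace ℝ (Fin m))

/-- `G(x, θ) = ∂g(x, θ)/∂θ'`. -/
def G (x : 𝓧) (θ : EuclideanSpace ℝ (Fin p)) : Matrix (Fin m) (Fin p) ℝ :=
  jacobian (g x) θ

/-- `vec[G(x, θ)']`. -/
def vecG (x : 𝓧) (θ : EuclideanSpace ℝ (Fin p)) : EuclideanSpace ℝ (Fin m × Fin p) :=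
  WithLp.toLp 2 (Matrix.vec (G g x θ)ᵀ)

/-- `F(x, θ) = ∂vec[G(x, θ)']/∂θ'`. -/
def F (x : 𝓧) (θ : EuclideanSpace ℝ (Fin p)) : Matrix (Fin m × Fin p) (Fin p) ℝ :=
  jacobian (vecG g x) θ

/-- The augmented moment function `ψ(x, θ) = (g(x, θ), vec[G(x, θ)'])`. -/
def psi (x : 𝓧) (θ : EuclideanSpace ℝ (Fin p)) : EuclideanSpace ℝ (AugIdx m p) :=
  WithLp.toLp 2 (Sum.elim (g x θ).ofLp (vecG g x θ).ofLp)

variable [MeasurableSpace 𝓧] (μ : Measure 𝓧)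

/-- The population moments `g(θ) = E[g(X, θ)]`. -/
def popMoment (θ : EuclideanSpace ℝ (Fin p)) : EuclideanSpace ℝ (Fin m) :=
  ∫ x, g x θ ∂μ

/-- The population Jacobian `G(θ) = E[G(X, θ)]`. -/
def popG (θ : EuclideanSpace ℝ (Fin p)) : Matrix (Fin m) (Fin p) ℝ :=
  Matrix.of fun i j => ∫ x, G g x θ i j ∂μ

/-- `Γ(θ) = E[∂ψ(X, θ)/∂θ']`. -/
def Gam (θ : EuclideanSpace ℝ (Fin p)) : Matrix (AugIdx m p) (Fin p) ℝ :=
  Matrix.of fun k j => ∫ x, jacobian (psi g x) θ k j ∂μ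

/-- `Σ(θ) = E[ψ(X, θ) ψ(X, θ)'] - E[ψ(X, θ)] E[ψ(X, θ)]'`. -/
def Sig (θ : EuclideanSpace ℝ (Fin p)) : Matrix (AugIdx m p) (AugIdx m p) ℝ :=
  Matrix.of fun k l =>
    (∫ x, psi g x θ k * psi g x θ l ∂μ) - (∫ x, psi g x θ k ∂μ) * ∫ x, psi g x θ l ∂μ

/-- The recentered augmented moment function `ψ(x, θ) - E[ψ(X, θ₀)]`, where `θ₀` is the
pseudo-true value. -/
def psiTilde (θ₀ : EuclideanSpace ℝ (Fin p)) (x : 𝓧) (θ : EuclideanSpace ℝ (Fin p)) :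
    EuclideanSpace ℝ (AugIdx m p) :=
  psi g x θ - ∫ y, psi g y θ₀ ∂μ

/-- `A(W, θ) = [G(θ)'W   g(θ)'W ⊗ I_p]`. -/
def A (W : Matrix (Fin m) (Fin m) ℝ) (θ : EuclideanSpace ℝ (Fin p)) :
    Matrix (Fin p) (AugIdx m p) ℝ :=
  Matrix.fromCols ((popG g μ θ)ᵀ * W)
    ((Matrix.replicateRow Unit ((popMoment g μ θ).ofLp ᵥ* W) ⊗ₖ
      (1 : Matrix (Fin p) (Fin p) ℝ)).submatrix (fun j => ((), j)) id)

/-- `V_M(Λ, θ) = (ΛΓ(θ))⁻¹ Λ Σ(θ) Λ' ((ΛΓ(θ))')⁻¹`. -/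
def VM (Λ : Matrix (Fin p) (AugIdx m p) ℝ) (θ : EuclideanSpace ℝ (Fin p)) :
    Matrix (Fin p) (Fin p) ℝ :=
  (Λ * Gam g μ θ)⁻¹ * Λ * Sig g μ θ * Λᵀ * ((Λ * Gam g μ θ)ᵀ)⁻¹

/-- `θ₀` is the GMM pseudo-true value for the weighting matrix `W`: the unique minimizer over the
parameter space `Θ` of the population criterion `g(θ)' W g(θ)`. -/
def IsPseudoTrueValue (W : Matrix (Fin m) (Fin m) ℝ) (Θ : Set (EuclideanSpace ℝ (Fin p)))
    (θ₀ : EuclideanSpace ℝ (Fin p)) : Prop :=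
  θ₀ ∈ Θ ∧ ∀ θ ∈ Θ, θ ≠ θ₀ → quadForm W (popMoment g μ θ₀) < quadForm W (popMoment g μ θ)

end Moments

section Sample

variable [MeasurableSpace Ω] (P : Measure Ω) (X : ℕ → Ω → 𝓧)
  (g : 𝓧 → EuclideanSpace ℝ (Fin p) → EuclideanSpace ℝ (Fin m))

/-- The mean `n⁻¹ ∑ f(Xᵢ, θ)` over the first `n` observations. -/
def sampleMean {κ : Type*} (f : 𝓧 → EuclideanSpace ℝ (Fin p) → EuclideanSpace ℝ κ)
    (n : ℕ) (ω : Ω) (θ : EuclideanSpace ℝ (Fin p)) : EuclideanSpace ℝ κ :=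
  (n : ℝ)⁻¹ • ∑ i ∈ Finset.range n, f (X i ω) θ

/-- `est` is a sequence of augmented Z-estimators: with probability tending to one it solves
`Λ · n⁻¹ ∑ (ψ(Xᵢ, θ) - E[ψ(X, θ₀)]) = 0` in `θ ∈ Θ`. (In a finite sample there may be no solution.
`P` of a set that is not measurable is its outer measure.) -/
def IsZEstimator [MeasurableSpace 𝓧] (μ : Measure 𝓧) (Θ : Set (EuclideanSpace ℝ (Fin p)))
    (θ₀ : EuclideanSpace ℝ (Fin p)) (Λ : Matrix (Fin p) (AugIdx m p) ℝ)
    (est : ℕ → Ω → EuclideanSpace ℝ (Fin p)) : Prop :=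
  (∀ n, AEMeasurable (est n) P) ∧
  Tendsto (fun n => P {ω | ¬ (est n ω ∈ Θ ∧
    apply Λ (sampleMean X (psiTilde g μ θ₀) n ω (est n ω)) = 0)}) atTop (𝓝 0)

/-- `est` is a sequence of GMM estimators: with probability tending to one it minimizes
`gₙ(θ)' W gₙ(θ)` over `Θ`, where `gₙ(θ) = n⁻¹ ∑ g(Xᵢ, θ)`. -/
def IsGMMEstimator (Θ : Set (EuclideanSpace ℝ (Fin p))) (W : Matrix (Fin m) (Fin m) ℝ)
    (est : ℕ → Ω → EuclideanSpace ℝ (Fin p)) : Prop :=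
  (∀ n, AEMeasurable (est n) P) ∧
  Tendsto (fun n => P {ω | ¬ (est n ω ∈ Θ ∧
    IsMinOn (fun θ => quadForm W (sampleMean X g n ω θ)) Θ (est n ω))}) atTop (𝓝 0)

/-- The influence function representation
`√n (est - θ₀) = -(ΛΓ(θ₀))⁻¹ Λ n^{-1/2} ∑ (ψ(Xᵢ, θ₀) - E[ψ(X, θ₀)]) + o_p(1)`. -/
def HasInfluenceRepr [MeasurableSpace 𝓧] (μ : Measure 𝓧)
    (θ₀ : EuclideanSpace ℝ (Fin p)) (Λ : Matrix (Fin p) (AugIdx m p) ℝ)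
    (est : ℕ → Ω → EuclideanSpace ℝ (Fin p)) : Prop :=
  TendstoInMeasure P
    (fun (n : ℕ) ω => √(n : ℝ) • (est n ω - θ₀) -
      (- apply ((Λ * Gam g μ θ₀)⁻¹ * Λ)
        ((√(n : ℝ))⁻¹ • ∑ i ∈ Finset.range n, psiTilde g μ θ₀ (X i ω) θ₀)))
    atTop (fun _ => 0)

/-- `√n (est - θ₀)` converges in distribution to `N(0, V)`. -/
def IsAsympNormal [IsProbabilityMeasure P] (θ₀ : EuclideanSpace ℝ (Fin p))
    (est : ℕ → Ω → EuclideanSpace ℝ (Fin p)) (V : Matrix (Fin p) (Fin p) ℝ) : Prop :=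
  TendstoInDistribution (fun (n : ℕ) ω => √(n : ℝ) • (est n ω - θ₀)) atTop
    (id : EuclideanSpace ℝ (Fin p) → EuclideanSpace ℝ (Fin p))
    (fun _ => P) (multivariateGaussian 0 V)

end Sample

end AugmentedGMM

end

/-! Write ψ₀ = E ψ(X, θ_W), let a be the sample mean of ψ at the estimator minus ψ₀, s the same
difference at θ_W, and d the estimation error. Both estimators are consistent and satisfy Λa = o(a).
A linearization with error uniform in the sample size gives a = s + Γd + o(d), and nonsingularity of
ΛΓ turns these two facts into d = -(ΛΓ)⁻¹Λs + o(s) (`isLittleO_of_approximate_zero`). Multiplying by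
√n and using the central limit theorem for √n s gives both conclusions.

For the Z-estimator Λa = 0 outside events of vanishing probability. For GMM the first-order
condition G'Wg = 0 is a homogeneous quadratic equation b(h, h) = 0 in the augmented moment vector h.
Expanding at h = ψ₀ + a, the constant term is the population first-order condition, the linear term
is A(W, θ_W)a (`apply_A`), and the rest is b(a, a) = o(a). Hence Λ = A(W, θ_W), even when g(θ_W) ≠
0.

Consistency and linearization are proved path by path from a uniform strong law, obtained as the
strong law in the Banach space of continuous functions on a compact set.
`tendstoInMeasure_zero_of_isLittleO` carries the pathwise o(s) back to convergence in probability.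
-/

namespace AugmentedGMM

/-! ### Uniform strong law over a compact set -/

section UniformLaw

variable {𝓧 T H H' : Type*} [MeasurableSpace 𝓧] {μ : Measure 𝓧} [PseudoMetricSpace T] {K : Set T}
  [NormedAddCommGroup H] [NormedAddCommGroup H']

/-- A map into `C(Y, H)` all of whose evaluations are a.e. strongly measurable is itself a.e.
strongly measurable. -/
theorem aestronglyMeasurable_continuousMap {Y : Type*} [PseudoMetricSpace Y] [CompactSpace Y]
    [SecondCountableTopology H] {φ : 𝓧 → C(Y, H)}
    (h : ∀ y, AEStronglyMeasurable (fun x => φ x y) μ) : AEStronglyMeasurable φ μ := by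
  borelize C(Y, H)
  obtain ⟨D, hDc, hD⟩ := TopologicalSpace.exists_countable_dense Y
  have key : ∀ (c : C(Y, H)) (r : ℝ), NullMeasurableSet (φ ⁻¹' Metric.closedBall c r) μ := by
    intro c r
    rcases lt_or_ge r 0 with hr | hr
    · simp [Metric.closedBall_eq_empty.2 hr]
    -- By continuity the sup norm need only be checked on a countable dense set, so the ball is a
    -- countable intersection of pointwise conditions.
    have : φ ⁻¹' Metric.closedBall c r = ⋂ y ∈ D, {x | ‖φ x y - c y‖ ≤ r} := by
      ext x
      rw [Set.mem_preimage, Metric.mem_closedBall, ContinuousMap.dist_le hr]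
      simp only [dist_eq_norm, Set.mem_iInter, Set.mem_ofPred_eq]
      refine ⟨fun hx y _ => hx y, fun hx y => ?_⟩
      have hcl : IsClosed {y | ‖φ x y - c y‖ ≤ r} := isClosed_le (by fun_prop) continuous_const
      have : closure D ⊆ {y | ‖φ x y - c y‖ ≤ r} := hcl.closure_subset_iff.2 hx
      exact this (hD y)
    rw [this]
    refine NullMeasurableSet.biInter hDc fun y _ => ?_
    exact nullMeasurableSet_le ((h y).sub aestronglyMeasurable_const).norm.aemeasurable
      aemeasurable_const
  have hopen : ∀ O, IsOpen O → NullMeasurableSet (φ ⁻¹' O) μ := by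
    intro O hO
    obtain ⟨D, hDc, hD⟩ := TopologicalSpace.exists_countable_dense C(Y, H)
    -- C(Y, H) is separable, so countably many closed balls exhaust an open set.
    have hO' : O = ⋃ c ∈ D, ⋃ q : ℚ, ⋃ _ : Metric.closedBall c (q : ℝ) ⊆ O,
        Metric.closedBall c (q : ℝ) := by
      refine Set.Subset.antisymm (fun f hf => ?_) ?_
      · obtain ⟨ε, hε, hεO⟩ := Metric.isOpen_iff.1 hO f hf
        obtain ⟨q, hq0, hq⟩ := exists_rat_btwn (half_pos hε)
        obtain ⟨c, hcD, hc⟩ := hD.exists_dist_lt f hq0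
        simp only [Set.mem_iUnion]
        refine ⟨c, hcD, q, fun z hz => hεO ?_, hc.le⟩
        have h1 := dist_triangle z c f
        rw [Metric.mem_closedBall] at hz
        rw [dist_comm] at hc
        rw [Metric.mem_ball]
        linarith
      · simp only [Set.iUnion_subset_iff]
        exact fun _ _ _ hq => hq
    rw [hO']
    simp only [Set.preimage_iUnion]
    exact NullMeasurableSet.biUnion hDc fun c _ => NullMeasurableSet.iUnion fun q =>
      NullMeasurableSet.iUnion fun _ => key c q
  have hnull : NullMeasurable φ μ := measurable_of_isOpen (δ := NullMeasurableSpace 𝓧 μ) hopen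
  exact hnull.aemeasurable.aestronglyMeasurable

/-- A random function which is continuous on `K`, measurable at each point of `K`, and dominated
on `K` by an integrable envelope. -/
structure IsDominatedOn (μ : Measure 𝓧) (K : Set T) (f : 𝓧 → T → H) : Prop where
  continuousOn : ∀ᵐ x ∂μ, ContinuousOn (f x) K
  aestronglyMeasurable : ∀ t ∈ K, AEStronglyMeasurable (fun x => f x t) μ
  bound : ∃ b : 𝓧 → ℝ, Integrable b μ ∧ ∀ᵐ x ∂μ, ∀ t ∈ K, ‖f x t‖ ≤ b x

namespace IsDominatedOn

variable {f f' : 𝓧 → T → H}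

theorem integrable (hf : IsDominatedOn μ K f) {t : T} (ht : t ∈ K) :
    Integrable (fun x => f x t) μ := by
  obtain ⟨b, hb, hfb⟩ := hf.bound
  exact hb.mono' (hf.aestronglyMeasurable t ht) (hfb.mono fun x hx => hx t ht)

theorem mono {K' : Set T} (hf : IsDominatedOn μ K f) (h : K' ⊆ K) : IsDominatedOn μ K' f where
  continuousOn := hf.continuousOn.mono fun _ hx => hx.mono h
  aestronglyMeasurable t ht := hf.aestronglyMeasurable t (h ht)
  bound := by
    obtain ⟨b, hb, hfb⟩ := hf.bound
    exact ⟨b, hb, hfb.mono fun x hx t ht => hx t (h ht)⟩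

theorem congr (hf : IsDominatedOn μ K f) (h : ∀ᵐ x ∂μ, ∀ t ∈ K, f x t = f' x t) :
    IsDominatedOn μ K f' where
  continuousOn := by
    filter_upwards [hf.continuousOn, h] with x hx hx'
    exact hx.congr fun t ht => (hx' t ht).symm
  aestronglyMeasurable t ht :=
    (hf.aestronglyMeasurable t ht).congr (h.mono fun x hx => hx t ht)
  bound := by
    obtain ⟨b, hb, hfb⟩ := hf.bound
    refine ⟨b, hb, ?_⟩
    filter_upwards [hfb, h] with x hx hx' t ht
    exact hx' t ht ▸ hx t ht

theorem add (hf : IsDominatedOn μ K f) (hf' : IsDominatedOn μ K f') :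
    IsDominatedOn μ K (fun x t => f x t + f' x t) where
  continuousOn := by
    filter_upwards [hf.continuousOn, hf'.continuousOn] with x hx hx'
    exact hx.add hx'
  aestronglyMeasurable t ht := (hf.aestronglyMeasurable t ht).add (hf'.aestronglyMeasurable t ht)
  bound := by
    obtain ⟨b, hb, hfb⟩ := hf.bound
    obtain ⟨b', hb', hfb'⟩ := hf'.bound
    refine ⟨b + b', hb.add hb', ?_⟩
    filter_upwards [hfb, hfb'] with x hx hx' t ht
    exact (norm_add_le _ _).trans (add_le_add (hx t ht) (hx' t ht))

/-- Views f as a random element of C(K, H). The default 0 of `ContinuousMap.mkD` is taken only on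
the null set where f x is not continuous on K. -/
theorem integrable_mkD [SecondCountableTopology H] [CompactSpace K] (hf : IsDominatedOn μ K f) :
    Integrable (fun x => ContinuousMap.mkD (K.domRestrict (f x)) 0) μ := by
  obtain ⟨b, hb, hfb⟩ := hf.bound
  refine hb.abs.mono' (aestronglyMeasurable_continuousMap fun t => ?_) ?_
  · refine (hf.aestronglyMeasurable t t.2).congr ?_
    filter_upwards [hf.continuousOn] with x hx
    exact (ContinuousMap.mkD_apply_of_continuousOn hx).symm
  · filter_upwards [hf.continuousOn, hfb] with x hx hxb
    rw [ContinuousMap.norm_le _ (abs_nonneg _)]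
    intro t
    rw [ContinuousMap.mkD_apply_of_continuousOn hx]
    exact (hxb t t.2).trans (le_abs_self _)

variable [NormedSpace ℝ H] [NormedSpace ℝ H']

theorem clm_comp (L : H →L[ℝ] H') (hf : IsDominatedOn μ K f) :
    IsDominatedOn μ K (fun x t => L (f x t)) where
  continuousOn := hf.continuousOn.mono fun _ hx => L.continuous.comp_continuousOn hx
  aestronglyMeasurable t ht :=
    L.continuous.comp_aestronglyMeasurable (hf.aestronglyMeasurable t ht)
  bound := by
    obtain ⟨b, hb, hfb⟩ := hf.bound
    refine ⟨fun x => ‖L‖ * b x, hb.const_mul _, hfb.mono fun x hx t ht => ?_⟩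
    exact (L.le_opNorm _).trans (mul_le_mul_of_nonneg_left (hx t ht) (norm_nonneg _))

theorem integral_mkD_apply [SecondCountableTopology H] [CompactSpace K] [CompleteSpace H]
    (hf : IsDominatedOn μ K f) (t : K) :
    (∫ x, ContinuousMap.mkD (K.domRestrict (f x)) 0 ∂μ) t = ∫ x, f x t ∂μ := by
  have h := (ContinuousMap.evalCLM ℝ t : C(K, H) →L[ℝ] H).integral_comp_comm hf.integrable_mkD
  rw [ContinuousMap.evalCLM_apply] at h
  rw [← h]
  refine integral_congr_ae ?_
  filter_upwards [hf.continuousOn] with x hx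
  exact ContinuousMap.mkD_apply_of_continuousOn hx

theorem continuousOn_integral [SecondCountableTopology H] [CompleteSpace H] (hK : IsCompact K)
    (hf : IsDominatedOn μ K f) : ContinuousOn (fun t => ∫ x, f x t ∂μ) K := by
  have := isCompact_iff_compactSpace.1 hK
  rw [continuousOn_iff_continuous_domRestrict]
  refine (∫ x, ContinuousMap.mkD (K.domRestrict (f x)) 0 ∂μ).continuous.congr fun t => ?_
  exact hf.integral_mkD_apply t

end IsDominatedOn

/-- An uncountable supremum need not be measurable. The envelope is therefore the norm of the random
element of C(K, H), which is measurable and a.e. at most that supremum. -/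
theorem isDominatedOn_of_lintegral_iSup [SecondCountableTopology H] (hK : IsCompact K)
    {f : 𝓧 → T → H} (hcont : ∀ᵐ x ∂μ, ContinuousOn (f x) K)
    (hmeas : ∀ t ∈ K, AEStronglyMeasurable (fun x => f x t) μ)
    (hsup : ∫⁻ x, ⨆ t ∈ K, ‖f x t‖ₑ ∂μ < ⊤) : IsDominatedOn μ K f where
  continuousOn := hcont
  aestronglyMeasurable := hmeas
  bound := by
    have := isCompact_iff_compactSpace.1 hK
    have hmk : AEStronglyMeasurable (fun x => ContinuousMap.mkD (K.domRestrict (f x)) 0) μ := by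
      refine aestronglyMeasurable_continuousMap fun t => ?_
      refine (hmeas t t.2).congr ?_
      filter_upwards [hcont] with x hx
      exact (ContinuousMap.mkD_apply_of_continuousOn hx).symm
    refine ⟨fun x => ‖ContinuousMap.mkD (K.domRestrict (f x)) 0‖, ⟨hmk.norm, ?_⟩, ?_⟩
    · refine lt_of_le_of_lt (lintegral_mono_ae ?_) hsup
      filter_upwards [hcont] with x hx
      rw [enorm_norm]
      by_contra! hlt
      obtain ⟨c, hc1, hc2⟩ := exists_between hlt
      have hctop : c ≠ ⊤ := (hc2.trans_le le_top).ne
      have : ‖ContinuousMap.mkD (K.domRestrict (f x)) 0‖ ≤ c.toReal := by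
        rw [ContinuousMap.norm_le _ ENNReal.toReal_nonneg]
        intro t
        rw [ContinuousMap.mkD_apply_of_continuousOn hx, ← toReal_enorm]
        exact ENNReal.toReal_mono hctop ((le_iSup₂ (f := fun t (_ : t ∈ K) => ‖f x t‖ₑ) t.1 t.2).trans
          hc1.le)
      rw [← toReal_enorm, ENNReal.toReal_le_toReal enorm_ne_top hctop] at this
      exact absurd hc2 this.not_gt
    · filter_upwards [hcont] with x hx t ht
      have := ContinuousMap.norm_coe_le_norm (ContinuousMap.mkD (K.domRestrict (f x)) 0) ⟨t, ht⟩
      rwa [ContinuousMap.mkD_apply_of_continuousOn hx] at this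

/-- Uniform strong law of large numbers over a compact set. -/
theorem IsDominatedOn.ae_tendstoUniformlyOn_mean [NormedSpace ℝ H] [SecondCountableTopology H] [CompleteSpace H]
    {Ω : Type*} [MeasurableSpace Ω] {P : Measure Ω} {X : ℕ → Ω → 𝓧}
    (hX_law : ∀ i, HasLaw (X i) μ P) (hX_indep : iIndepFun X P) (hK : IsCompact K)
    {f : 𝓧 → T → H} (hf : IsDominatedOn μ K f) :
    ∀ᵐ ω ∂P, TendstoUniformlyOn
      (fun (n : ℕ) t => (n : ℝ)⁻¹ • ∑ i ∈ Finset.range n, f (X i ω) t)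
      (fun t => ∫ x, f x t ∂μ) atTop K := by
  have := isCompact_iff_compactSpace.1 hK
  borelize C(K, H)
  set φ : 𝓧 → C(K, H) := fun x => ContinuousMap.mkD (K.domRestrict (f x)) 0 with hφ
  have hφi : Integrable φ μ := hf.integrable_mkD
  have hlaw : HasLaw φ (μ.map φ) μ := ⟨hφi.aemeasurable, rfl⟩
  have hlaw' (i) : HasLaw (φ ∘ X i) (μ.map φ) P := hlaw.comp (hX_law i)
  have hint : Integrable (φ ∘ X 0) P := by
    refine Integrable.comp_aemeasurable ?_ (hX_law 0).aemeasurable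
    rwa [(hX_law 0).map_eq]
  have hind : iIndepFun (fun i => φ ∘ X i) P :=
    hX_indep.comp₀ (fun _ => φ) (fun i => (hX_law i).aemeasurable)
      (fun i => by rw [(hX_law i).map_eq]; exact hφi.aemeasurable)
  -- Norm convergence in C(K, H) is uniform convergence on K, so one Banach-valued strong law
  -- suffices.
  have hslln := strong_law_ae (fun i => φ ∘ X i) hint (fun i j hij => hind.indepFun hij)
    (fun i => ⟨(hlaw' i).aemeasurable, (hlaw' 0).aemeasurable,
      (hlaw' i).map_eq.trans (hlaw' 0).map_eq.symm⟩)
  have hmean : ∫ ω, (φ ∘ X 0) ω ∂P = ∫ x, φ x ∂μ := by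
    have := (hX_law 0).integral_comp (f := φ) hφi.aestronglyMeasurable
    exact this
  have hXc : ∀ᵐ ω ∂P, ∀ i, ContinuousOn (f (X i ω)) K := by
    rw [ae_all_iff]
    intro i
    have h := hf.continuousOn
    rw [← (hX_law i).map_eq] at h
    exact ae_of_ae_map (hX_law i).aemeasurable h
  filter_upwards [hslln, hXc] with ω hω hc
  rw [hmean, ContinuousMap.tendsto_iff_tendstoUniformly] at hω
  rw [tendstoUniformlyOn_iff_tendstoUniformly_comp_coe]
  convert! hω using 2 with n t
  · ext t
    simp only [Function.comp, ContinuousMap.coe_smul, Pi.smul_apply, ContinuousMap.coe_sum,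
      Finset.sum_apply]
    congr 1
    refine Finset.sum_congr rfl fun i _ => ?_
    exact (ContinuousMap.mkD_apply_of_continuousOn (hc i)).symm
  · ext t
    exact (hf.integral_mkD_apply t).symm

end UniformLaw

/-! ### Central limit theorem and stochastic orders -/

section Probability

variable {Ω Ω' : Type*} [MeasurableSpace Ω] [MeasurableSpace Ω'] {P : Measure Ω}

theorem aemeasurable_comp_of_hasLaw {𝓧 H : Type*} [MeasurableSpace 𝓧] [MeasurableSpace H]
    {μ : Measure 𝓧} {X : Ω → 𝓧} (hX : HasLaw X μ P) {f : 𝓧 → H} (hf : AEMeasurable f μ) :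
    AEMeasurable (fun ω => f (X ω)) P :=
  AEMeasurable.comp_aemeasurable (g := f) (by rwa [hX.map_eq]) hX.aemeasurable

theorem aemeasurable_smul_sum {𝓧 H : Type*} [MeasurableSpace 𝓧] [NormedAddCommGroup H]
    [NormedSpace ℝ H] [MeasurableSpace H] [BorelSpace H] [SecondCountableTopology H]
    {μ : Measure 𝓧} {X : ℕ → Ω → 𝓧} (hX_law : ∀ i, HasLaw (X i) μ P) {f : 𝓧 → H}
    (hf : AEMeasurable f μ) (c : ℝ) (n : ℕ) :
    AEMeasurable (fun ω => c • ∑ i ∈ Finset.range n, f (X i ω)) P := by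
  have := Finset.aemeasurable_fun_sum (Finset.range n)
    fun i (_ : i ∈ Finset.range n) => aemeasurable_comp_of_hasLaw (hX_law i) hf
  exact (continuous_const_smul c).measurable.comp_aemeasurable this

variable [IsProbabilityMeasure P] {P' : Measure Ω'} [IsProbabilityMeasure P']

/-- Central limit theorem for centered i.i.d. real random variables, in terms of characteristic
functions. -/
theorem tendsto_charFun_inv_sqrt_mul_sum {𝓧 : Type*} [MeasurableSpace 𝓧]
    {μ : Measure 𝓧} {X : ℕ → Ω → 𝓧} (hX_law : ∀ i, HasLaw (X i) μ P) (hX_indep : iIndepFun X P)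
    {h : 𝓧 → ℝ} (hh : MemLp h 2 μ) (h0 : ∫ x, h x ∂μ = 0) :
    Tendsto (fun n : ℕ => charFun (P.map fun ω => (√(n : ℝ))⁻¹ • ∑ i ∈ Finset.range n, h (X i ω)) 1)
      atTop (𝓝 (Complex.exp (-((∫ x, h x ^ 2 ∂μ : ℝ) : ℂ) / 2))) := by
  have hhm : AEMeasurable h μ := hh.aestronglyMeasurable.aemeasurable
  have hlaw : HasLaw h (μ.map h) μ := ⟨hhm, rfl⟩
  have hlaw' (i) : HasLaw (h ∘ X i) (μ.map h) P := hlaw.comp (hX_law i)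
  have hident (i) : IdentDistrib (h ∘ X i) (h ∘ X 0) P P :=
    ⟨(hlaw' i).aemeasurable, (hlaw' 0).aemeasurable, (hlaw' i).map_eq.trans (hlaw' 0).map_eq.symm⟩
  have hind : iIndepFun (fun i => h ∘ X i) P :=
    hX_indep.comp₀ (fun _ => h) (fun i => (hX_law i).aemeasurable)
      (fun i => by rw [(hX_law i).map_eq]; exact hhm)
  have hL2' : MemLp (h ∘ X 0) 2 P := by
    refine MemLp.comp_of_map ?_ (hX_law 0).aemeasurable
    rwa [(hX_law 0).map_eq]
  have hmean : ∫ ω, (h ∘ X 0) ω ∂P = 0 := by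
    rw [(hX_law 0).integral_comp hhm.aestronglyMeasurable, h0]
  have hvar : Var[h ∘ X 0; P] = ∫ x, h x ^ 2 ∂μ := by
    rw [variance_eq_integral (hlaw' 0).aemeasurable, hmean]
    simp only [sub_zero]
    exact (hX_law 0).integral_comp (f := fun x => h x ^ 2)
      (hhm.pow_const 2).aestronglyMeasurable
  set Y : ℕ → Ω → ℝ := fun i => h ∘ X i with hY
  have hvarY : Var[Y 0; P] = ∫ x, h x ^ 2 ∂μ := hvar
  set γ : Measure ℝ := gaussianReal 0 Var[Y 0; P].toNNReal with hγ
  have hγp : IsProbabilityMeasure γ := by rw [hγ]; infer_instance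
  have hlawγ : HasLaw (id : ℝ → ℝ) γ γ := HasLaw.id
  have hclt := tendstoInDistribution_inv_sqrt_mul_sum_sub (X := Y) hlawγ hL2' hind hident
  have hchar := ProbabilityMeasure.tendsto_iff_tendsto_charFun.1 hclt.tendsto 1
  simp only [ProbabilityMeasure.coe_mk, Measure.map_id] at hchar
  have hnn : 0 ≤ ∫ x, h x ^ 2 ∂μ := integral_nonneg fun _ => sq_nonneg _
  have hlim : charFun γ 1 =
      Complex.exp (-((∫ x, h x ^ 2 ∂μ : ℝ) : ℂ) / 2) := by
    rw [hγ, charFun_gaussianReal, hvarY]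
    simp [hnn, neg_div]
  rw [hlim] at hchar
  refine hchar.congr fun n => ?_
  have hY0 : ∫ ω, Y 0 ω ∂P = 0 := hmean
  rw [hY0, mul_zero]
  simp only [sub_zero]
  rfl

/-- Multivariate central limit theorem for centered i.i.d. random vectors. -/
theorem tendstoInDistribution_multivariateGaussian {𝓧 ι : Type*} [MeasurableSpace 𝓧]
    {μ : Measure 𝓧} [Fintype ι] [DecidableEq ι] {X : ℕ → Ω → 𝓧}
    (hX_law : ∀ i, HasLaw (X i) μ P) (hX_indep : iIndepFun X P)
    {f : 𝓧 → EuclideanSpace ℝ ι} (hf : MemLp f 2 μ) (hf0 : ∫ x, f x ∂μ = 0)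
    {S : Matrix ι ι ℝ} (hS : S.PosSemidef)
    (hcov : ∀ t : EuclideanSpace ℝ ι, ∫ x, inner ℝ t (f x) ^ 2 ∂μ = t.ofLp ⬝ᵥ (S *ᵥ t.ofLp)) :
    TendstoInDistribution
      (fun (n : ℕ) ω => (√(n : ℝ))⁻¹ • ∑ i ∈ Finset.range n, f (X i ω)) atTop
      (id : EuclideanSpace ℝ ι → EuclideanSpace ℝ ι) (fun _ => P) (multivariateGaussian 0 S) := by
  have : IsProbabilityMeasure μ := (hX_law 0).isProbabilityMeasure_iff.1 inferInstance
  have hfm : AEMeasurable f μ := hf.aestronglyMeasurable.aemeasurable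
  refine ⟨fun n => aemeasurable_smul_sum hX_law hfm _ n, aemeasurable_id, ?_⟩
  refine ProbabilityMeasure.tendsto_iff_tendsto_charFun.2 fun t => ?_
  have hmean : ∫ x, inner ℝ t (f x) ∂μ = 0 := by
    have := (innerSL ℝ t).integral_comp_comm (hf.integrable (by norm_num))
    rw [hf0, map_zero] at this
    exact this
  have hL2 : MemLp (fun x => inner ℝ t (f x)) 2 μ := (innerSL ℝ t).comp_memLp' hf
  -- Cramér–Wold: the characteristic function of the vector at t is that of its inner product with t
  -- at 1.
  have hchar := tendsto_charFun_inv_sqrt_mul_sum hX_law hX_indep hL2 hmean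
  rw [hcov t] at hchar
  simp only [ProbabilityMeasure.coe_mk, Measure.map_id]
  rw [charFun_multivariateGaussian hS]
  have hexp : Complex.exp (((inner ℝ t (0 : EuclideanSpace ℝ ι) : ℝ) : ℂ) * Complex.I -
      ((t.ofLp ⬝ᵥ (S *ᵥ t.ofLp) : ℝ) : ℂ) / 2) =
      Complex.exp (-((t.ofLp ⬝ᵥ (S *ᵥ t.ofLp) : ℝ) : ℂ) / 2) := by
    rw [inner_zero_right]; simp [neg_div]
  rw [hexp]
  refine hchar.congr fun n => ?_
  rw [charFun_apply, charFun_apply,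
    integral_map (aemeasurable_smul_sum hX_law hfm _ n) (by fun_prop),
    integral_map (aemeasurable_smul_sum hX_law hL2.aestronglyMeasurable.aemeasurable _ n)
      (by fun_prop)]
  refine integral_congr_ae (Eventually.of_forall fun ω => ?_)
  simp [inner_smul_left, sum_inner, real_inner_comm]

/-- Portmanteau for the closed set of points at distance at least ε from c, which is null for the
Dirac mass at c. -/
theorem tendstoInMeasure_of_tendstoInDistribution_const {H : Type*} [NormedAddCommGroup H]
    [MeasurableSpace H] [BorelSpace H] {R : ℕ → Ω → H} {c : H}
    (h : TendstoInDistribution R atTop (fun _ : Ω' => c) (fun _ => P) P') :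
    TendstoInMeasure P R atTop fun _ => c := by
  rw [tendstoInMeasure_iff_norm]
  intro ε hε
  have hcl : IsClosed {x : H | ε ≤ ‖x - c‖} := isClosed_le continuous_const (by fun_prop)
  have hls := ProbabilityMeasure.limsup_measure_closed_le_of_tendsto h.tendsto hcl
  simp only [ProbabilityMeasure.coe_mk] at hls
  have hzero : (P'.map fun _ => c) {x : H | ε ≤ ‖x - c‖} = 0 := by
    simp [Measure.map_const, hcl.measurableSet, hε]
  rw [hzero] at hls
  refine tendsto_of_le_liminf_of_limsup_le bot_le ?_
  refine hls.trans' (le_of_eq (congrArg (limsup · atTop) (funext fun n => ?_)))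
  exact (Measure.map_apply_of_aemeasurable (h.forall_aemeasurable n) hcl.measurableSet).symm

/-- If `R = o(Z)` holds almost surely along every subsequence that avoids events of vanishing
probability, and `Z` converges in distribution, then `R` tends to zero in probability. -/
theorem tendstoInMeasure_zero_of_isLittleO {H H' : Type*} [NormedAddCommGroup H]
    [MeasurableSpace H] [BorelSpace H] [SecondCountableTopology H]
    [NormedAddCommGroup H'] [MeasurableSpace H'] [BorelSpace H'] [SecondCountableTopology H']
    {R : ℕ → Ω → H} {Z : ℕ → Ω → H'} {Y : Ω' → H'} {B : ℕ → Set Ω}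
    (hR : ∀ n, AEMeasurable (R n) P)
    (hZ : TendstoInDistribution Z atTop Y (fun _ => P) P')
    (hB : Tendsto (fun n => P (B n)) atTop (𝓝 0))
    (h : ∀ᵐ ω ∂P, ∀ ns : ℕ → ℕ, Tendsto ns atTop atTop → (∀ᶠ k in atTop, ω ∉ B (ns k)) →
      (fun k => R (ns k) ω) =o[atTop] fun k => Z (ns k) ω) :
    TendstoInMeasure P R atTop fun _ => 0 := by
  -- The ratio tends to 0 in probability even where Z vanishes, thanks to the added 1; multiplying
  -- back by the tight factor 1 + ‖Z‖ recovers ‖R‖.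
  set c : ℕ → Ω → ℝ := fun n ω => ‖R n ω‖ / (1 + ‖Z n ω‖) with hc
  have hcm (n) : AEMeasurable (c n) P :=
    (hR n).norm.div ((hZ.forall_aemeasurable n).norm.const_add 1)
  have hind : TendstoInMeasure P (fun n => (B n).indicator fun _ => (1 : ℝ)) atTop
      fun _ => 0 := by
    rw [tendstoInMeasure_iff_norm]
    intro ε hε
    refine tendsto_of_tendsto_of_tendsto_of_le_of_le tendsto_const_nhds hB
      (fun _ => zero_le) fun n => measure_mono fun ω hω => ?_
    by_contra hn
    simp only [Set.mem_ofPred_eq, Set.indicator_of_notMem hn, sub_zero, norm_zero] at hω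
    exact absurd hε hω.not_gt
  have hc0 : TendstoInMeasure P c atTop fun _ => 0 := by
    rw [exists_seq_tendstoInMeasure_atTop_iff fun n => (hcm n).aestronglyMeasurable]
    intro ns hns
    -- Along a further subsequence the indicators of the bad events tend to 0 a.s., so almost every
    -- path eventually avoids them. The events need not be measurable.
    obtain ⟨ns', hns', hae⟩ := (hind.comp hns.tendsto_atTop).exists_seq_tendsto_ae
    refine ⟨ns', hns', ?_⟩
    filter_upwards [h, hae] with ω hω hBω
    have hlo := hω (fun k => ns (ns' k)) (hns.tendsto_atTop.comp hns'.tendsto_atTop) ?_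
    · rw [Metric.tendsto_nhds]
      intro ε hε
      filter_upwards [hlo.def (half_pos hε)] with k hk
      have hpos : 0 < 1 + ‖Z (ns (ns' k)) ω‖ := by positivity
      rw [Real.dist_eq, sub_zero, abs_of_nonneg (by positivity)]
      rw [div_lt_iff₀ hpos]
      nlinarith [norm_nonneg (Z (ns (ns' k)) ω)]
    · have := hBω.eventually (gt_mem_nhds (zero_lt_one' ℝ))
      filter_upwards [this] with k hk hmem
      simp [Set.indicator_of_mem hmem] at hk
  -- Slutsky: the product c(1 + ‖Z‖) = ‖R‖ converges in distribution to 0.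
  have hd := hZ.continuous_comp_prodMk_of_tendstoInMeasure_const
    (g := fun q : H' × ℝ => q.2 * (1 + ‖q.1‖)) (by fun_prop) hc0 hcm
  simp only [zero_mul] at hd
  have hm := tendstoInMeasure_of_tendstoInDistribution_const hd
  rw [tendstoInMeasure_iff_norm] at hm ⊢
  intro ε hε
  refine (hm ε hε).congr fun n => ?_
  congr 1
  ext ω
  have hpos : 0 < 1 + ‖Z n ω‖ := by positivity
  simp only [hc, Set.mem_ofPred_eq, sub_zero, div_mul_cancel₀ _ hpos.ne', norm_norm]

end Probability

/-! ### Pathwise consistency and linearization -/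

section Deterministic

variable {E H : Type*} [NormedAddCommGroup E] [NormedSpace ℝ E] [NormedAddCommGroup H]

/-- Consistency of extremum estimators along one path. -/
theorem tendsto_of_le_of_unique_min {ι T : Type*} [TopologicalSpace T] {l : Filter ι} {K : Set T}
    (hK : IsCompact K) {F : ι → T → H} {f : T → H} (hF : TendstoUniformlyOn F f l K)
    (hf : ContinuousOn f K) {q : H → ℝ} (hq : Continuous q) {x : ι → T} {x₀ : T} (hx₀ : x₀ ∈ K)
    (hmin : ∀ y ∈ K, y ≠ x₀ → q (f x₀) < q (f y)) (hx : ∀ᶠ k in l, x k ∈ K)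
    (hle : ∀ᶠ k in l, q (F k (x k)) ≤ q (F k x₀)) : Tendsto x l (𝓝 x₀) := by
  -- Along an ultrafilter, compactness gives a limit y in K; passing the inequality to the limit
  -- forces y = x₀.
  rw [tendsto_iff_ultrafilter]
  intro U hU
  have hxU : ∀ᶠ k in (U : Filter ι), x k ∈ K := hU hx
  obtain ⟨y, hyK, hy⟩ := hK.ultrafilter_le_nhds' (U.map x) hxU
  have hxy : Tendsto x U (𝓝 y) := hy
  have hFU : TendstoUniformlyOn F f U K := fun u hu => hU (hF u hu)
  have h1 : Tendsto (fun k => F k (x k)) U (𝓝 (f y)) :=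
    hFU.tendsto_comp (hf y hyK) (tendsto_nhdsWithin_iff.2 ⟨hxy, hxU⟩)
  have h2 : Tendsto (fun k => F k x₀) U (𝓝 (f x₀)) := hFU.tendsto_at hx₀
  have h3 : q (f y) ≤ q (f x₀) :=
    le_of_tendsto_of_tendsto ((hq.tendsto _).comp h1) ((hq.tendsto _).comp h2) (hU hle)
  by_cases hyx : y = x₀
  · exact hyx ▸ hxy
  · exact absurd h3 (hmin y hyK hyx).not_ge

variable [NormedSpace ℝ H]

/-- Mean value inequality on a small ball: D n θ is ε/2-close to D₀ θ by uniform convergence, and D₀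
θ is ε/2-close to D₀ θ₀ by continuity. The product filter allows θ to vary with n. -/
theorem isLittleO_linearization {Φ : ℕ → E → H} {D : ℕ → E → E →L[ℝ] H} {D₀ : E → E →L[ℝ] H}
    {θ₀ : E} {s : Set E} (hs : s ∈ 𝓝 θ₀)
    (hΦ : ∀ n, ∀ θ ∈ s, HasFDerivAt (Φ n) (D n θ) θ) (hD : TendstoUniformlyOn D D₀ atTop s)
    (hD₀ : ContinuousAt D₀ θ₀) :
    (fun q : ℕ × E => Φ q.1 q.2 - Φ q.1 θ₀ - D₀ θ₀ (q.2 - θ₀)) =o[atTop ×ˢ 𝓝 θ₀]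
      fun q => q.2 - θ₀ := by
  rw [Asymptotics.isLittleO_iff]
  intro ε hε
  obtain ⟨δ, hδ, hball⟩ := Metric.mem_nhds_iff.1
    (inter_mem hs (Metric.continuousAt_iff'.1 hD₀ (ε / 2) (half_pos hε)))
  have h1 := Metric.tendstoUniformlyOn_iff.1 hD (ε / 2) (half_pos hε)
  filter_upwards [h1.prod_mk (Metric.ball_mem_nhds θ₀ hδ)] with q hq
  refine (convex_ball θ₀ δ).norm_image_sub_le_of_norm_hasFDerivWithin_le'
    (f' := D q.1) (fun θ hθ => (hΦ q.1 θ (hball hθ).1).hasFDerivWithinAt) (fun θ hθ => ?_)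
    (Metric.mem_ball_self hδ) hq.2
  have ha := hq.1 θ (hball hθ).1
  have hb : dist (D₀ θ) (D₀ θ₀) < ε / 2 := (hball hθ).2
  rw [← dist_eq_norm]
  rw [dist_comm] at ha
  linarith [dist_triangle (D q.1 θ) (D₀ θ) (D₀ θ₀)]

/-- Asymptotic linearity of approximate zeros: if `a = s + Γ d + o(d)` and `Λ a = o(a)`, then
`d = -(ΛΓ)⁻¹ Λ s + o(s)`. -/
theorem isLittleO_of_approximate_zero {ι : Type*} {l : Filter ι} {a s : ι → H} {d : ι → E}
    {Γ : E →L[ℝ] H} {Λ : H →L[ℝ] E} {M : E →L[ℝ] E} (hM : ∀ v, M (Λ (Γ v)) = v)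
    (ha : (fun k => a k - s k - Γ (d k)) =o[l] d) (hΛ : (fun k => Λ (a k)) =o[l] a) :
    (fun k => d k + M (Λ (s k))) =o[l] s := by
  set r : ι → E := fun k => d k + M (Λ (s k)) with hr
  -- N dominates s, r, d and a, so every error is o(N); the share of r in N is absorbed at the end.
  set N : ι → ℝ := fun k => ‖s k‖ + ‖r k‖ with hN
  have hsN : s =O[l] N := Asymptotics.isBigO_of_le _ fun k => by
    rw [Real.norm_of_nonneg (by positivity)]; exact le_add_of_nonneg_right (norm_nonneg _)
  have hrN : r =O[l] N := Asymptotics.isBigO_of_le _ fun k => by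
    rw [Real.norm_of_nonneg (by positivity)]; exact le_add_of_nonneg_left (norm_nonneg _)
  have hdN : d =O[l] N := by
    have : d = fun k => r k - (M ∘L Λ) (s k) := by ext k; simp [hr]
    rw [this]
    exact hrN.sub (((M ∘L Λ).isBigO_comp _ _).trans hsN)
  have haN : a =O[l] N := by
    have : a = fun k => (a k - s k - Γ (d k)) + (s k + Γ (d k)) := by ext k; abel
    rw [this]
    exact (ha.isBigO.trans hdN).add (hsN.add ((Γ.isBigO_comp _ _).trans hdN))
  have hrlo : r =o[l] N := by
    have : r = fun k => M (Λ (a k)) - (M ∘L Λ) (a k - s k - Γ (d k)) := by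
      ext k
      simp only [hr, ContinuousLinearMap.comp_apply, map_sub, hM]
      abel
    rw [this]
    exact (((M.isBigO_comp _ _).trans_isLittleO hΛ).trans_isBigO haN).sub
      ((((M ∘L Λ).isBigO_comp _ _).trans_isLittleO ha).trans_isBigO hdN)
  rw [Asymptotics.isLittleO_iff] at hrlo ⊢
  intro c hc
  -- ‖r‖ ≤ c/(1 + c) · (‖s‖ + ‖r‖) rearranges to ‖r‖ ≤ c‖s‖.
  have hc' : 0 < c / (1 + c) := by positivity
  filter_upwards [hrlo hc'] with k hk
  rw [Real.norm_of_nonneg (by positivity : 0 ≤ N k), div_mul_eq_mul_div,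
    le_div_iff₀ (by positivity)] at hk
  simp only [hN] at hk
  linarith

end Deterministic

/-! ### Matrices as continuous linear maps -/

section LinearAlgebra

variable {κ ι ν : Type*} [Fintype κ] [Fintype ι] [Fintype ν]

/-- `apply M` as a continuous linear map. -/
noncomputable def applyL (M : Matrix κ ι ℝ) : EuclideanSpace ℝ ι →L[ℝ] EuclideanSpace ℝ κ :=
  LinearMap.toContinuousLinearMap
    { toFun := apply M
      map_add' := fun v w => by simp [apply, Matrix.mulVec_add]
      map_smul' := fun c v => by simp [apply, Matrix.mulVec_smul] }

@[simp]
theorem applyL_apply (M : Matrix κ ι ℝ) (v : EuclideanSpace ℝ ι) : applyL M v = apply M v := rfl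

theorem apply_mul (M : Matrix κ ι ℝ) (N : Matrix ι ν ℝ) (v : EuclideanSpace ℝ ν) :
    apply (M * N) v = apply M (apply N v) := by
  simp [apply, Matrix.mulVec_mulVec]

theorem apply_one [DecidableEq ι] (v : EuclideanSpace ℝ ι) : apply (1 : Matrix ι ι ℝ) v = v := by
  simp [apply]

theorem inner_apply (M : Matrix κ ι ℝ) (t : EuclideanSpace ℝ κ) (v : EuclideanSpace ℝ ι) :
    inner ℝ t (apply M v) = inner ℝ (apply Mᵀ t) v := by
  simp only [apply, EuclideanSpace.inner_eq_star_dotProduct, star_trivial]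
  rw [Matrix.mulVec_transpose, dotProduct_comm, Matrix.dotProduct_mulVec, dotProduct_comm]

theorem norm_apply_le [DecidableEq ι] (M : Matrix κ ι ℝ) (v : EuclideanSpace ℝ ι) :
    ‖apply M v‖ ≤ ‖M‖ * ‖v‖ :=
  Matrix.l2_opNorm_mulVec M v

theorem clm_eq_apply {p : ℕ} (T : EuclideanSpace ℝ (Fin p) →L[ℝ] EuclideanSpace ℝ κ)
    (v : EuclideanSpace ℝ (Fin p)) :
    T v = apply (Matrix.of fun k j => T (EuclideanSpace.single j 1) k) v := by
  have hv : v = ∑ j, v j • EuclideanSpace.single j (1 : ℝ) := by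
    have := (EuclideanSpace.basisFun (Fin p) ℝ).sum_repr v
    simpa using this.symm
  conv_lhs => rw [hv]
  ext k
  simp [apply, Matrix.mulVec, dotProduct, mul_comm]

theorem clm_eq_sum_smulRight {p : ℕ} {H : Type*} [NormedAddCommGroup H] [NormedSpace ℝ H]
    (T : EuclideanSpace ℝ (Fin p) →L[ℝ] H) :
    T = ∑ j, (EuclideanSpace.proj j : EuclideanSpace ℝ (Fin p) →L[ℝ] ℝ).smulRight
      (T (EuclideanSpace.single j 1)) := by
  ext v
  have hv : v = ∑ j, v j • EuclideanSpace.single j (1 : ℝ) := by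
    have := (EuclideanSpace.basisFun (Fin p) ℝ).sum_repr v
    simpa using this.symm
  conv_lhs => rw [hv]
  simp [map_sum]

end LinearAlgebra

/-! ### Derivatives and integrability of the augmented moments -/

section Calculus

variable {𝓧 : Type*} {m p : ℕ}

theorem fderiv_eq_apply_jacobian {κ : Type*} [Fintype κ]
    (f : EuclideanSpace ℝ (Fin p) → EuclideanSpace ℝ κ) (θ v : EuclideanSpace ℝ (Fin p)) :
    fderiv ℝ f θ v = apply (jacobian f θ) v :=
  clm_eq_apply _ v

/-- The matrix norm in scope is the spectral norm, so the moment bounds assumed on G and F pass to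
the Fréchet derivatives. -/
theorem enorm_fderiv_le_jacobian {κ : Type*} [Fintype κ]
    (f : EuclideanSpace ℝ (Fin p) → EuclideanSpace ℝ κ) (θ : EuclideanSpace ℝ (Fin p)) :
    ‖fderiv ℝ f θ‖ₑ ≤ ‖jacobian f θ‖ₑ := by
  rw [enorm_le_iff_norm_le]
  refine ContinuousLinearMap.opNorm_le_bound _ (norm_nonneg _) fun v => ?_
  rw [fderiv_eq_apply_jacobian]
  exact norm_apply_le _ _

/-- `vec[M']` as a function of the linear map with matrix `M`. -/
noncomputable def vecL :
    (EuclideanSpace ℝ (Fin p) →L[ℝ] EuclideanSpace ℝ (Fin m)) →L[ℝ]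
      EuclideanSpace ℝ (Fin m × Fin p) :=
  LinearMap.toContinuousLinearMap
    { toFun := fun T => WithLp.toLp 2 fun q => T (EuclideanSpace.single q.2 1) q.1
      map_add' := fun _ _ => rfl
      map_smul' := fun _ _ => rfl }

/-- Inclusion of the moments into the augmented moments. -/
noncomputable def inlL : EuclideanSpace ℝ (Fin m) →L[ℝ] EuclideanSpace ℝ (AugIdx m p) :=
  LinearMap.toContinuousLinearMap
    { toFun := fun v => WithLp.toLp 2 (Sum.elim v.ofLp 0)
      map_add' := fun v w => by ext (i | i) <;> simp
      map_smul' := fun c v => by ext (i | i) <;> simp }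

/-- Inclusion of the Jacobian entries into the augmented moments. -/
noncomputable def inrL : EuclideanSpace ℝ (Fin m × Fin p) →L[ℝ] EuclideanSpace ℝ (AugIdx m p) :=
  LinearMap.toContinuousLinearMap
    { toFun := fun v => WithLp.toLp 2 (Sum.elim 0 v.ofLp)
      map_add' := fun v w => by ext (i | i) <;> simp
      map_smul' := fun c v => by ext (i | i) <;> simp }

variable {g : 𝓧 → EuclideanSpace ℝ (Fin p) → EuclideanSpace ℝ (Fin m)}

theorem psi_eq (x : 𝓧) (θ : EuclideanSpace ℝ (Fin p)) :
    psi g x θ = inlL (g x θ) + inrL (vecG g x θ) := by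
  ext (i | i) <;> simp [psi, inlL, inrL]

theorem contDiffAt_vecG {x : 𝓧} {θ : EuclideanSpace ℝ (Fin p)} (h : ContDiffAt ℝ 2 (g x) θ) :
    ContDiffAt ℝ 1 (vecG g x) θ :=
  vecL.contDiff.contDiffAt.comp θ (h.fderiv_right (m := 1) (by norm_num))

theorem hasFDerivAt_psi {x : 𝓧} {θ : EuclideanSpace ℝ (Fin p)} (h : ContDiffAt ℝ 2 (g x) θ) :
    HasFDerivAt (psi g x) (inlL ∘L fderiv ℝ (g x) θ + inrL ∘L fderiv ℝ (vecG g x) θ) θ := by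
  have h1 := (h.differentiableAt (by norm_num)).hasFDerivAt
  have h2 := ((contDiffAt_vecG h).differentiableAt (by norm_num)).hasFDerivAt
  have := (inlL.hasFDerivAt.comp θ h1).add ((inrL (m := m) (p := p)).hasFDerivAt.comp θ h2)
  refine this.congr_of_eventuallyEq (Eventually.of_forall fun θ => ?_)
  exact psi_eq x θ

variable [MeasurableSpace 𝓧] {μ : Measure 𝓧} {Θ : Set (EuclideanSpace ℝ (Fin p))}

/-- Directional derivatives are limits of measurable difference quotients, and finitely many of them
determine the derivative. Measurability is asked only near θ because that of `vecG` is available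
only on Θ. -/
theorem aestronglyMeasurable_fderiv {H : Type*} [NormedAddCommGroup H] [NormedSpace ℝ H]
    {f : 𝓧 → EuclideanSpace ℝ (Fin p) → H} {θ : EuclideanSpace ℝ (Fin p)}
    (hd : ∀ᵐ x ∂μ, DifferentiableAt ℝ (f x) θ)
    (hm : ∀ᶠ θ' in 𝓝 θ, AEStronglyMeasurable (fun x => f x θ') μ) :
    AEStronglyMeasurable (fun x => fderiv ℝ (f x) θ) μ := by
  have hdir (v : EuclideanSpace ℝ (Fin p)) :
      AEStronglyMeasurable (fun x => fderiv ℝ (f x) θ v) μ := by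
    have hlim : Tendsto (fun n : ℕ => θ + (n : ℝ)⁻¹ • v) atTop (𝓝 θ) := by
      have := (tendsto_inv_atTop_nhds_zero_nat (𝕜 := ℝ)).smul_const v
      simpa using this.const_add θ
    -- The shift by N keeps all difference quotients in the neighbourhood where f is measurable.
    obtain ⟨N, hN⟩ := eventually_atTop.1 (hlim.eventually hm)
    refine aestronglyMeasurable_of_tendsto_ae atTop
      (f := fun (n : ℕ) x => ((n + N : ℕ) : ℝ) • (f x (θ + ((n + N : ℕ) : ℝ)⁻¹ • v) - f x θ))
      (fun n => ((hN _ (Nat.le_add_left N n)).sub hm.self_of_nhds).const_smul _) ?_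
    filter_upwards [hd] with x hx
    exact (hx.hasFDerivAt.lim_real v).comp
      (tendsto_natCast_atTop_atTop.comp (tendsto_add_atTop_nat N))
  have hsum : (fun x => fderiv ℝ (f x) θ) = fun x => ∑ j,
      ContinuousLinearMap.smulRightL ℝ (EuclideanSpace ℝ (Fin p)) H
        (EuclideanSpace.proj j : EuclideanSpace ℝ (Fin p) →L[ℝ] ℝ)
        (fderiv ℝ (f x) θ (EuclideanSpace.single j 1)) := by
    ext1 x
    exact clm_eq_sum_smulRight _
  rw [hsum]
  exact Finset.aestronglyMeasurable_fun_sum _ fun j _ =>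
    (ContinuousLinearMap.continuous _).comp_aestronglyMeasurable (hdir _)

theorem isDominatedOn_g (hΘ : IsCompact Θ) (hg_meas : ∀ θ, Measurable fun x => g x θ)
    (hg_smooth : ∀ᵐ x ∂μ, ∀ θ ∈ Θ, ContDiffAt ℝ 2 (g x) θ)
    (hg_sup : ∫⁻ x, ⨆ θ ∈ Θ, ‖g x θ‖ₑ ∂μ < ⊤) : IsDominatedOn μ Θ g :=
  isDominatedOn_of_lintegral_iSup hΘ
    (hg_smooth.mono fun _ hx θ hθ => (hx θ hθ).continuousAt.continuousWithinAt)
    (fun θ _ => (hg_meas θ).aestronglyMeasurable) hg_sup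

theorem isDominatedOn_fderiv_g (hΘ : IsCompact Θ) (hg_meas : ∀ θ, Measurable fun x => g x θ)
    (hg_smooth : ∀ᵐ x ∂μ, ∀ θ ∈ Θ, ContDiffAt ℝ 2 (g x) θ)
    (hG_sup : ∫⁻ x, ⨆ θ ∈ Θ, ‖G g x θ‖ₑ ∂μ < ⊤) :
    IsDominatedOn μ Θ (fun x θ => fderiv ℝ (g x) θ) := by
  refine isDominatedOn_of_lintegral_iSup hΘ ?_ (fun θ hθ => ?_) ?_
  · exact hg_smooth.mono fun _ hx θ hθ =>
      ((hx θ hθ).fderiv_right (m := 1) (by norm_num)).continuousAt.continuousWithinAt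
  · exact aestronglyMeasurable_fderiv
      (hg_smooth.mono fun x hx => (hx θ hθ).differentiableAt (by norm_num))
      (Eventually.of_forall fun θ' => (hg_meas θ').aestronglyMeasurable)
  · exact lt_of_le_of_lt (lintegral_mono fun x => iSup₂_mono fun θ _ =>
      enorm_fderiv_le_jacobian (g x) θ) hG_sup

/-- Each point of s must be interior to Θ, so that difference quotients of `vecG` stay where it is
known to be measurable. -/
theorem isDominatedOn_fderiv_vecG {s : Set (EuclideanSpace ℝ (Fin p))} (hs : IsCompact s)
    (hsΘ : s ⊆ interior Θ)
    (hg_smooth : ∀ᵐ x ∂μ, ∀ θ ∈ Θ, ContDiffAt ℝ 2 (g x) θ)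
    (hvec : IsDominatedOn μ Θ (vecG g)) (hF_sup : ∫⁻ x, ⨆ θ ∈ Θ, ‖F g x θ‖ₑ ∂μ < ⊤) :
    IsDominatedOn μ s (fun x θ => fderiv ℝ (vecG g x) θ) := by
  refine isDominatedOn_of_lintegral_iSup hs ?_ (fun θ hθ => ?_) ?_
  · exact hg_smooth.mono fun _ hx θ hθ =>
      ((contDiffAt_vecG (hx θ (interior_subset (hsΘ hθ)))).fderiv_right (m := 0)
        (by norm_num)).continuousAt.continuousWithinAt
  · refine aestronglyMeasurable_fderiv (hg_smooth.mono fun x hx =>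
      (contDiffAt_vecG (hx θ (interior_subset (hsΘ hθ)))).differentiableAt (by norm_num)) ?_
    filter_upwards [mem_interior_iff_mem_nhds.1 (hsΘ hθ)] with θ' hθ'
    exact hvec.aestronglyMeasurable θ' hθ'
  · refine lt_of_le_of_lt (lintegral_mono fun x => ?_) hF_sup
    refine iSup₂_le fun θ hθ => (enorm_fderiv_le_jacobian (vecG g x) θ).trans ?_
    exact le_iSup₂ (f := fun θ (_ : θ ∈ Θ) => ‖F g x θ‖ₑ) θ (interior_subset (hsΘ hθ))

theorem isDominatedOn_psi (hg : IsDominatedOn μ Θ g) (hvec : IsDominatedOn μ Θ (vecG g)) :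
    IsDominatedOn μ Θ (psi g) :=
  ((hg.clm_comp inlL).add (hvec.clm_comp inrL)).congr
    (Eventually.of_forall fun x θ _ => (psi_eq x θ).symm)

theorem isDominatedOn_fderiv_psi {s : Set (EuclideanSpace ℝ (Fin p))}
    (hg_smooth : ∀ᵐ x ∂μ, ∀ θ ∈ s, ContDiffAt ℝ 2 (g x) θ)
    (hG : IsDominatedOn μ s (fun x θ => fderiv ℝ (g x) θ))
    (hF : IsDominatedOn μ s (fun x θ => fderiv ℝ (vecG g x) θ)) :
    IsDominatedOn μ s (fun x θ => fderiv ℝ (psi g x) θ) := by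
  refine ((hG.clm_comp (ContinuousLinearMap.compL ℝ _ _ _ inlL)).add
    (hF.clm_comp (ContinuousLinearMap.compL ℝ _ _ _ inrL))).congr ?_
  filter_upwards [hg_smooth] with x hx θ hθ
  exact (hasFDerivAt_psi (hx θ hθ)).fderiv.symm

theorem memLp_psi {θ : EuclideanSpace ℝ (Fin p)} (hg_meas : ∀ θ, Measurable fun x => g x θ)
    (hd : ∀ᵐ x ∂μ, DifferentiableAt ℝ (g x) θ)
    (hg_sq : ∫⁻ x, ‖g x θ‖ₑ ^ 2 ∂μ < ⊤) (hG_sq : ∫⁻ x, ‖G g x θ‖ₑ ^ 2 ∂μ < ⊤) :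
    MemLp (fun x => psi g x θ) 2 μ := by
  have h1 : MemLp (fun x => g x θ) 2 μ := by
    refine ⟨(hg_meas θ).aestronglyMeasurable, ?_⟩
    rw [eLpNorm_lt_top_iff_lintegral_rpow_enorm_lt_top (by norm_num) (by norm_num)]
    simpa using hg_sq
  have h2 : MemLp (fun x => fderiv ℝ (g x) θ) 2 μ := by
    refine ⟨aestronglyMeasurable_fderiv hd
      (Eventually.of_forall fun θ' => (hg_meas θ').aestronglyMeasurable), ?_⟩
    rw [eLpNorm_lt_top_iff_lintegral_rpow_enorm_lt_top (by norm_num) (by norm_num)]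
    refine lt_of_le_of_lt (lintegral_mono fun x => ?_) hG_sq
    simp only [ENNReal.toReal_ofNat, ENNReal.rpow_ofNat]
    gcongr
    exact enorm_fderiv_le_jacobian (g x) θ
  have h3 := (inlL (m := m) (p := p)).comp_memLp' h1
  have h4 := ((inrL (m := m) (p := p)) ∘L vecL).comp_memLp' h2
  refine (h3.add h4).ae_eq (Eventually.of_forall fun x => ?_)
  exact (psi_eq x θ).symm

theorem integral_coord {ι : Type*} [Fintype ι] {f : 𝓧 → EuclideanSpace ℝ ι}
    (hf : Integrable f μ) (k : ι) : (∫ x, f x ∂μ) k = ∫ x, f x k ∂μ :=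
  ((EuclideanSpace.proj k : EuclideanSpace ℝ ι →L[ℝ] ℝ).integral_comp_comm hf).symm

theorem integral_fderiv_psi_eq {θ : EuclideanSpace ℝ (Fin p)}
    (h : Integrable (fun x => fderiv ℝ (psi g x) θ) μ) :
    ∫ x, fderiv ℝ (psi g x) θ ∂μ = applyL (Gam g μ θ) := by
  ext1 v
  rw [clm_eq_apply, applyL_apply]
  congr 1
  ext k j
  simp only [Matrix.of_apply, Gam, jacobian]
  rw [ContinuousLinearMap.integral_apply h, integral_coord (h.apply_continuousLinearMap _)]

end Calculus

/-! ### Covariance matrix and Gaussian limit -/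

section Covariance

variable {𝓧 : Type*} [MeasurableSpace 𝓧] {μ : Measure 𝓧} [IsProbabilityMeasure μ] {m p : ℕ}
  {g : 𝓧 → EuclideanSpace ℝ (Fin p) → EuclideanSpace ℝ (Fin m)} {θ : EuclideanSpace ℝ (Fin p)}

theorem Sig_eq_covariance (h : MemLp (fun x => psi g x θ) 2 μ) (k l : AugIdx m p) :
    Sig g μ θ k l = cov[fun x => psi g x θ k, fun x => psi g x θ l; μ] := by
  have hk (k) : MemLp (fun x => psi g x θ k) 2 μ :=
    (EuclideanSpace.proj k : EuclideanSpace ℝ (AugIdx m p) →L[ℝ] ℝ).comp_memLp' h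
  rw [covariance_eq_sub (hk k) (hk l)]
  rfl

theorem memLp_psiTilde (h : MemLp (fun x => psi g x θ) 2 μ) :
    MemLp (fun x => psiTilde g μ θ x θ) 2 μ :=
  h.sub (memLp_const _)

theorem integral_psiTilde {θ₀ : EuclideanSpace ℝ (Fin p)}
    (h : Integrable (fun x => psi g x θ) μ) :
    ∫ x, psiTilde g μ θ₀ x θ ∂μ = ∫ x, psi g x θ ∂μ - ∫ x, psi g x θ₀ ∂μ := by
  simp only [psiTilde]
  rw [integral_sub h (integrable_const _)]
  simp

/-- Expanding the square yields one covariance per pair of coordinates. This supplies positive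
semidefiniteness of Σ and the variances for the central limit theorem. -/
theorem integral_inner_psiTilde_sq (h : MemLp (fun x => psi g x θ) 2 μ)
    (t : EuclideanSpace ℝ (AugIdx m p)) :
    ∫ x, inner ℝ t (psiTilde g μ θ x θ) ^ 2 ∂μ = t.ofLp ⬝ᵥ (Sig g μ θ *ᵥ t.ofLp) := by
  have hi := h.integrable (by norm_num)
  have hk (k) : MemLp (fun x => psi g x θ k) 2 μ :=
    (EuclideanSpace.proj k : EuclideanSpace ℝ (AugIdx m p) →L[ℝ] ℝ).comp_memLp' h
  have hexp (x : 𝓧) : inner ℝ t (psiTilde g μ θ x θ) ^ 2 = ∑ k, ∑ l,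
      t k * t l * ((psi g x θ k - ∫ y, psi g y θ k ∂μ) * (psi g x θ l - ∫ y, psi g y θ l ∂μ)) := by
    rw [PiLp.inner_apply, sq, Finset.sum_mul_sum]
    refine Finset.sum_congr rfl fun k _ => Finset.sum_congr rfl fun l _ => ?_
    rw [← integral_coord hi, ← integral_coord hi]
    simp only [psiTilde, PiLp.sub_apply, RCLike.inner_apply, conj_trivial]
    ring
  have hint (k l) : Integrable (fun x => t k * t l *
      ((psi g x θ k - ∫ y, psi g y θ k ∂μ) * (psi g x θ l - ∫ y, psi g y θ l ∂μ))) μ :=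
    (((hk k).sub (memLp_const _)).integrable_mul ((hk l).sub (memLp_const _))).const_mul _
  simp only [hexp]
  rw [integral_finsetSum _ fun k _ => integrable_finsetSum _ fun l _ => hint k l]
  simp only [dotProduct, Matrix.mulVec, Finset.mul_sum]
  refine Finset.sum_congr rfl fun k _ => ?_
  rw [integral_finsetSum _ fun l _ => hint k l]
  refine Finset.sum_congr rfl fun l _ => ?_
  rw [integral_const_mul, Sig_eq_covariance h, covariance]
  ring

theorem posSemidef_Sig (h : MemLp (fun x => psi g x θ) 2 μ) : (Sig g μ θ).PosSemidef := by
  refine Matrix.PosSemidef.of_dotProduct_mulVec_nonneg ?_ fun t => ?_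
  · ext k l
    simp [Sig, mul_comm]
  · rw [star_trivial, ← integral_inner_psiTilde_sq h (WithLp.toLp 2 t)]
    exact integral_nonneg fun _ => sq_nonneg _

variable {Ω : Type*} [MeasurableSpace Ω] {P : Measure Ω} [IsProbabilityMeasure P]

/-- B is applied to each summand before the central limit theorem, so the limit has covariance BΣB'
without pushing a Gaussian law forward. -/
theorem tendstoInDistribution_apply_psiTilde {X : ℕ → Ω → 𝓧}
    (hX_law : ∀ i, HasLaw (X i) μ P) (hX_indep : iIndepFun X P)
    (h : MemLp (fun x => psi g x θ) 2 μ) {ι : Type*} [Fintype ι] [DecidableEq ι]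
    (B : Matrix ι (AugIdx m p) ℝ) :
    TendstoInDistribution
      (fun (n : ℕ) ω => apply B ((√(n : ℝ))⁻¹ • ∑ i ∈ Finset.range n, psiTilde g μ θ (X i ω) θ))
      atTop (id : EuclideanSpace ℝ ι → EuclideanSpace ℝ ι) (fun _ => P)
      (multivariateGaussian 0 (B * Sig g μ θ * Bᵀ)) := by
  have hps : (B * Sig g μ θ * Bᵀ).PosSemidef := (posSemidef_Sig h).mul_mul_conjTranspose_same B
  have hL := (applyL B).comp_memLp' (memLp_psiTilde h)
  have hmean : ∫ x, apply B (psiTilde g μ θ x θ) ∂μ = 0 := by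
    have := (applyL B).integral_comp_comm ((memLp_psiTilde h).integrable (by norm_num))
    rw [integral_psiTilde (h.integrable (by norm_num)), sub_self, map_zero] at this
    exact this
  have hclt := tendstoInDistribution_multivariateGaussian hX_law hX_indep hL hmean hps fun t => ?_
  · convert! hclt using 3 with n ω
    rw [← applyL_apply, map_smul, map_sum]
    rfl
  · simp only [Function.comp, applyL_apply, inner_apply]
    rw [integral_inner_psiTilde_sq h]
    simp only [apply, ← Matrix.mulVec_mulVec]
    rw [Matrix.mulVec_transpose, ← Matrix.dotProduct_mulVec]

end Covariance

/-! ### From approximate zeros to asymptotic normality -/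

section Estimators

variable {Ω 𝓧 : Type*} [MeasurableSpace 𝓧] {m p : ℕ} {μ : Measure 𝓧}
  {X : ℕ → Ω → 𝓧} {g : 𝓧 → EuclideanSpace ℝ (Fin p) → EuclideanSpace ℝ (Fin m)}
  {θW : EuclideanSpace ℝ (Fin p)}

/-- At n = 0 both sample means are 0 and the recentering term would be left over. -/
theorem sampleMean_psiTilde {n : ℕ} (hn : n ≠ 0) (ω : Ω) (θ : EuclideanSpace ℝ (Fin p)) :
    sampleMean X (psiTilde g μ θW) n ω θ =
      sampleMean X (psi g) n ω θ - ∫ x, psi g x θW ∂μ := by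
  have hn' : (n : ℝ) ≠ 0 := Nat.cast_ne_zero.2 hn
  simp only [sampleMean, psiTilde, Finset.sum_sub_distrib, Finset.sum_const, Finset.card_range,
    smul_sub]
  rw [← Nat.cast_smul_eq_nsmul ℝ, smul_smul, inv_mul_cancel₀ hn', one_smul]

theorem sqrt_smul_sampleMean_sub (n : ℕ) (hn : n ≠ 0) (ω : Ω) :
    √(n : ℝ) • (sampleMean X (psi g) n ω θW - ∫ x, psi g x θW ∂μ) =
      (√(n : ℝ))⁻¹ • ∑ i ∈ Finset.range n, psiTilde g μ θW (X i ω) θW := by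
  have hn' : (0 : ℝ) < n := Nat.cast_pos.2 (Nat.pos_of_ne_zero hn)
  rw [← sampleMean_psiTilde hn, sampleMean, smul_smul]
  congr 1
  rw [← div_eq_mul_inv, Real.sqrt_div_self', one_div]

variable [MeasurableSpace Ω] {P : Measure Ω}

theorem ae_comp_of_hasLaw (hX_law : ∀ i, HasLaw (X i) μ P) {q : 𝓧 → Prop}
    (h : ∀ᵐ x ∂μ, q x) : ∀ᵐ ω ∂P, ∀ i, q (X i ω) := by
  rw [ae_all_iff]
  intro i
  rw [← (hX_law i).map_eq] at h
  exact ae_of_ae_map (hX_law i).aemeasurable h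

/-- Along almost every path, the sample mean of the augmented moments is linearized by its
expected Jacobian, uniformly in the sample size. -/
theorem ae_isLittleO_sampleMean_psi (hX_law : ∀ i, HasLaw (X i) μ P) (hX_indep : iIndepFun X P)
    {s : Set (EuclideanSpace ℝ (Fin p))} (hs : IsCompact s) (hsθ : s ∈ 𝓝 θW)
    (hg_smooth : ∀ᵐ x ∂μ, ∀ θ ∈ s, ContDiffAt ℝ 2 (g x) θ)
    (hD : IsDominatedOn μ s (fun x θ => fderiv ℝ (psi g x) θ)) :
    ∀ᵐ ω ∂P, (fun q : ℕ × EuclideanSpace ℝ (Fin p) => sampleMean X (psi g) q.1 ω q.2 -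
      sampleMean X (psi g) q.1 ω θW - applyL (Gam g μ θW) (q.2 - θW)) =o[atTop ×ˢ 𝓝 θW]
        fun q => q.2 - θW := by
  filter_upwards [hD.ae_tendstoUniformlyOn_mean hX_law hX_indep hs,
    ae_comp_of_hasLaw hX_law hg_smooth] with ω hunif hsm
  rw [← integral_fderiv_psi_eq (hD.integrable (mem_of_mem_nhds hsθ))]
  refine isLittleO_linearization (Φ := fun n θ => sampleMean X (psi g) n ω θ)
    (D₀ := fun θ => ∫ x, fderiv ℝ (psi g x) θ ∂μ) hsθ
    (fun n θ hθ => ?_) hunif ((hD.continuousOn_integral hs).continuousAt hsθ)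
  refine (HasFDerivAt.fun_sum fun i _ => ?_).fun_const_smul _
  exact (hasFDerivAt_psi (hsm i θ hθ)).differentiableAt.hasFDerivAt

variable [IsProbabilityMeasure P] [IsProbabilityMeasure μ]

/-- A consistent approximate zero of the linear combination `Λ` of the recentered augmented
sample moments has the influence function representation and is asymptotically normal. -/
theorem isAsympNormal_and_hasInfluenceRepr (hX_law : ∀ i, HasLaw (X i) μ P)
    (hX_indep : iIndepFun X P)
    {s : Set (EuclideanSpace ℝ (Fin p))} (hs : IsCompact s) (hsθ : s ∈ 𝓝 θW)
    (hg_smooth : ∀ᵐ x ∂μ, ∀ θ ∈ s, ContDiffAt ℝ 2 (g x) θ)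
    (hD : IsDominatedOn μ s (fun x θ => fderiv ℝ (psi g x) θ))
    (hL2 : MemLp (fun x => psi g x θW) 2 μ)
    {Λ : Matrix (Fin p) (AugIdx m p) ℝ} (hΛ : IsUnit (Λ * Gam g μ θW))
    {est : ℕ → Ω → EuclideanSpace ℝ (Fin p)} (hest : ∀ n, AEMeasurable (est n) P)
    {B : ℕ → Set Ω} (hB : Tendsto (fun n => P (B n)) atTop (𝓝 0))
    (hpath : ∀ᵐ ω ∂P, ∀ ns : ℕ → ℕ, Tendsto ns atTop atTop → (∀ᶠ k in atTop, ω ∉ B (ns k)) →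
      Tendsto (fun k => est (ns k) ω) atTop (𝓝 θW) ∧
      (fun k => applyL Λ (sampleMean X (psi g) (ns k) ω (est (ns k) ω) -
        ∫ x, psi g x θW ∂μ)) =o[atTop]
        fun k => sampleMean X (psi g) (ns k) ω (est (ns k) ω) - ∫ x, psi g x θW ∂μ) :
    IsAsympNormal P θW est (VM g μ Λ θW) ∧ HasInfluenceRepr P X g μ θW Λ est := by
  set M := (Λ * Gam g μ θW)⁻¹ with hMdef
  set Z : ℕ → Ω → EuclideanSpace ℝ (AugIdx m p) := fun n ω =>
    (√(n : ℝ))⁻¹ • ∑ i ∈ Finset.range n, psiTilde g μ θW (X i ω) θW with hZ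
  set R : ℕ → Ω → EuclideanSpace ℝ (Fin p) := fun n ω =>
    √(n : ℝ) • (est n ω - θW) - (- apply (M * Λ) (Z n ω)) with hR
  have hYm (n : ℕ) : AEMeasurable (fun ω => √(n : ℝ) • (est n ω - θW)) P :=
    (show Continuous fun v : EuclideanSpace ℝ (Fin p) => √(n : ℝ) • (v - θW) by
      fun_prop).measurable.comp_aemeasurable (hest n)
  -- The coefficient 1 makes Z the tight sequence that controls the remainder; the coefficient -(MΛ)
  -- below gives the limit law.
  have hZlim := tendstoInDistribution_apply_psiTilde hX_law hX_indep hL2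
    (1 : Matrix (AugIdx m p) (AugIdx m p) ℝ)
  simp only [apply_one] at hZlim
  have hBlim := tendstoInDistribution_apply_psiTilde hX_law hX_indep hL2 (-(M * Λ))
  have hneg (v : EuclideanSpace ℝ (AugIdx m p)) : apply (-(M * Λ)) v = - apply (M * Λ) v := by
    simp [apply, Matrix.neg_mulVec]
  simp only [hneg] at hBlim
  have hV : -(M * Λ) * Sig g μ θW * (-(M * Λ))ᵀ = VM g μ Λ θW := by
    rw [VM, ← hMdef, Matrix.transpose_neg, Matrix.neg_mul, Matrix.neg_mul, Matrix.mul_neg, neg_neg,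
      Matrix.transpose_mul, hMdef, Matrix.transpose_nonsing_inv]
    simp only [Matrix.mul_assoc]
  rw [hV] at hBlim
  have hRm (n : ℕ) : AEMeasurable (R n) P := (hYm n).sub (hBlim.forall_aemeasurable n)
  have hMinv (v : EuclideanSpace ℝ (Fin p)) :
      applyL M (applyL Λ (applyL (Gam g μ θW) v)) = v := by
    simp only [applyL_apply, ← apply_mul]
    rw [hMdef,
      Matrix.nonsing_inv_mul _ ((Matrix.isUnit_iff_isUnit_det _).1 hΛ), apply_one]
  have hRlim : TendstoInMeasure P R atTop fun _ => 0 := by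
    refine tendstoInMeasure_zero_of_isLittleO hRm hZlim hB ?_
    filter_upwards [hpath, ae_isLittleO_sampleMean_psi hX_law hX_indep hs hsθ hg_smooth hD]
      with ω hω hlin ns hns hgood
    obtain ⟨hcons, hzero⟩ := hω ns hns hgood
    have hlin' := hlin.comp_tendsto (hns.prodMk hcons)
    have hr := isLittleO_of_approximate_zero (Γ := applyL (Gam g μ θW)) (Λ := applyL Λ)
      (M := applyL M) (l := atTop)
      (a := fun k => sampleMean X (psi g) (ns k) ω (est (ns k) ω) - ∫ x, psi g x θW ∂μ)
      (s := fun k => sampleMean X (psi g) (ns k) ω θW - ∫ x, psi g x θW ∂μ)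
      (d := fun k => est (ns k) ω - θW) hMinv ?_ hzero
    · have hr' := (Asymptotics.isBigO_refl (fun k => √(ns k : ℝ)) atTop).smul_isLittleO hr
      refine hr'.congr' ?_ ?_
      · filter_upwards [hns.eventually_ne_atTop 0] with k hk
        simp only [hR, hZ, ← sqrt_smul_sampleMean_sub _ hk]
        rw [smul_add, sub_neg_eq_add, apply_mul, ← applyL_apply, ← applyL_apply, map_smul,
          map_smul]
      · filter_upwards [hns.eventually_ne_atTop 0] with k hk
        exact sqrt_smul_sampleMean_sub _ hk ω
    · refine hlin'.congr_left fun k => ?_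
      simp only [Function.comp]
      abel
  exact ⟨tendstoInDistribution_of_tendstoInMeasure_sub _ _ hBlim hRlim hYm, hRlim⟩

/-- The augmented Z-estimator. -/
theorem IsZEstimator.isAsympNormal_and_hasInfluenceRepr (hX_law : ∀ i, HasLaw (X i) μ P)
    (hX_indep : iIndepFun X P) {Θ : Set (EuclideanSpace ℝ (Fin p))} (hΘ : IsCompact Θ)
    (hθW : θW ∈ Θ) (hψ : IsDominatedOn μ Θ (psi g))
    {s : Set (EuclideanSpace ℝ (Fin p))} (hs : IsCompact s) (hsθ : s ∈ 𝓝 θW)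
    (hg_smooth : ∀ᵐ x ∂μ, ∀ θ ∈ s, ContDiffAt ℝ 2 (g x) θ)
    (hD : IsDominatedOn μ s (fun x θ => fderiv ℝ (psi g x) θ))
    (hL2 : MemLp (fun x => psi g x θW) 2 μ)
    {Λ : Matrix (Fin p) (AugIdx m p) ℝ}
    (hid : ∀ θ ∈ Θ, θ ≠ θW → apply Λ (∫ x, psiTilde g μ θW x θ ∂μ) ≠ 0)
    (hΛ : IsUnit (Λ * Gam g μ θW))
    {est : ℕ → Ω → EuclideanSpace ℝ (Fin p)} (hest : IsZEstimator P X g μ Θ θW Λ est) :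
    IsAsympNormal P θW est (VM g μ Λ θW) ∧ HasInfluenceRepr P X g μ θW Λ est := by
  refine AugmentedGMM.isAsympNormal_and_hasInfluenceRepr hX_law hX_indep hs hsθ hg_smooth hD hL2
    hΛ hest.1 hest.2 ?_
  filter_upwards [hψ.ae_tendstoUniformlyOn_mean hX_law hX_indep hΘ] with ω hunif ns hns hgood
  have hzero : ∀ᶠ k in atTop, applyL Λ (sampleMean X (psi g) (ns k) ω (est (ns k) ω) -
      ∫ x, psi g x θW ∂μ) = 0 := by
    filter_upwards [hgood, hns.eventually_ne_atTop 0] with k hk hk0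
    simp only [not_not] at hk
    rw [← sampleMean_psiTilde hk0]
    exact hk.2
  refine ⟨?_, (Asymptotics.isLittleO_zero _ _).congr' (hzero.mono fun k hk => hk.symm)
    EventuallyEq.rfl⟩
  -- The criterion ‖Λ(v - ψ₀)‖ vanishes at the estimator, while identification makes its population
  -- version vanish on Θ only at θ_W.
  refine tendsto_of_le_of_unique_min hΘ (F := fun k θ => sampleMean X (psi g) (ns k) ω θ)
    (fun u hu => hns.eventually (hunif u hu)) (hψ.continuousOn_integral hΘ)
    (q := fun v => ‖applyL Λ (v - ∫ x, psi g x θW ∂μ)‖) (by fun_prop) hθW (fun θ hθ hne => ?_)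
    (hgood.mono fun k hk => ?_) (hzero.mono fun k hk => ?_)
  · rw [sub_self, map_zero, norm_zero, norm_pos_iff, ← integral_psiTilde (hψ.integrable hθ)]
    exact hid θ hθ hne
  · simp only [not_not] at hk
    exact hk.1
  · rw [hk, norm_zero]
    exact norm_nonneg _

end Estimators

/-! ### The first-order condition as a quadratic equation -/

section FirstOrderCondition

variable {m p : ℕ} {W : Matrix (Fin m) (Fin m) ℝ}

/-- The matrix `[G'W  0]` built from the Jacobian block of an augmented moment vector. -/
def crossMatrix (W : Matrix (Fin m) (Fin m) ℝ) (h : EuclideanSpace ℝ (AugIdx m p)) :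
    Matrix (Fin p) (AugIdx m p) ℝ :=
  Matrix.fromCols (Matrix.of (fun j i => h (Sum.inr (i, j))) * W) 0

/-- Displays the bilinearity in (h, v): Jacobian entries of h are paired with moments of v, and the
diagonal h = v is G'Wg. -/
theorem apply_crossMatrix (h v : EuclideanSpace ℝ (AugIdx m p)) (j : Fin p) :
    apply (crossMatrix W h) v j =
      ∑ k, ∑ i, h (Sum.inr (i, j)) * W i k * v (Sum.inl k) := by
  simp [apply, crossMatrix, Matrix.mulVec, dotProduct, Matrix.mul_apply, Finset.sum_mul]

theorem apply_crossMatrix_add (a b v w : EuclideanSpace ℝ (AugIdx m p)) :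
    apply (crossMatrix W (a + b)) (v + w) =
      apply (crossMatrix W a) v + apply (crossMatrix W a) w + apply (crossMatrix W b) v +
        apply (crossMatrix W b) w := by
  ext j
  simp only [apply_crossMatrix, PiLp.add_apply, ← Finset.sum_add_distrib]
  refine Finset.sum_congr rfl fun k _ => Finset.sum_congr rfl fun i _ => ?_
  ring

/-- Makes the quadratic remainder of the first-order condition o(a). -/
theorem tendsto_norm_crossMatrix {ι : Type*} {l : Filter ι}
    {a : ι → EuclideanSpace ℝ (AugIdx m p)} (ha : Tendsto a l (𝓝 0)) :
    Tendsto (fun k => ‖crossMatrix W (a k)‖) l (𝓝 0) := by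
  have hc : Continuous fun h : EuclideanSpace ℝ (AugIdx m p) => crossMatrix W h := by
    refine continuous_matrix fun j c => ?_
    rcases c with c | c
    · simp only [crossMatrix, Matrix.fromCols_apply_inl, Matrix.mul_apply, Matrix.of_apply]
      fun_prop
    · simp only [crossMatrix, Matrix.fromCols_apply_inr]
      fun_prop
  have h0 : crossMatrix W (0 : EuclideanSpace ℝ (AugIdx m p)) = 0 := by
    ext j (c | c) <;> simp [crossMatrix, Matrix.mul_apply]
  have := (hc.norm.tendsto 0).comp ha
  rwa [h0, norm_zero] at this

theorem quadForm_eq_inner (v : EuclideanSpace ℝ (Fin m)) :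
    quadForm W v = inner ℝ v (applyL W v) := by
  simp [quadForm, apply, EuclideanSpace.inner_eq_star_dotProduct, dotProduct_comm]

/-- First-order condition `G'Wg = 0` at an interior minimizer of `g'Wg`. -/
theorem apply_crossMatrix_self_eq_zero (hW : Wᵀ = W)
    {γ : EuclideanSpace ℝ (Fin p) → EuclideanSpace ℝ (Fin m)}
    {D : EuclideanSpace ℝ (Fin p) →L[ℝ] EuclideanSpace ℝ (Fin m)} {θ : EuclideanSpace ℝ (Fin p)}
    (hγ : HasFDerivAt γ D θ) (hmin : IsLocalMin (fun θ => quadForm W (γ θ)) θ)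
    {h : EuclideanSpace ℝ (AugIdx m p)} (hinl : ∀ i, h (Sum.inl i) = γ θ i)
    (hinr : ∀ i j, h (Sum.inr (i, j)) = D (EuclideanSpace.single j 1) i) :
    apply (crossMatrix W h) h = 0 := by
  have hd := hγ.inner ℝ ((applyL W).hasFDerivAt.comp θ hγ)
  have hmin' : IsLocalMin (fun θ => inner ℝ (γ θ) ((applyL W ∘ γ) θ)) θ := by
    simp only [quadForm_eq_inner] at hmin
    exact hmin
  have h0 := hmin'.hasFDerivAt_eq_zero hd
  ext j
  have hj := congrArg (fun T => T (EuclideanSpace.single j (1 : ℝ))) h0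
  simp only [ContinuousLinearMap.comp_apply, ContinuousLinearMap.prod_apply,
    fderivInnerCLM_apply, Function.comp, _root_.zero_apply, applyL_apply] at hj
  -- Symmetry of W merges the two product-rule terms into twice G'Wg.
  rw [inner_apply, hW, real_inner_comm (D _) (apply W (γ θ)), ← two_mul] at hj
  have hj' := (mul_eq_zero.1 hj).resolve_left two_ne_zero
  rw [PiLp.inner_apply] at hj'
  rw [apply_crossMatrix, PiLp.zero_apply, ← hj', Finset.sum_comm]
  refine Finset.sum_congr rfl fun i _ => ?_
  simp only [RCLike.inner_apply, conj_trivial, apply, Matrix.mulVec, dotProduct, Finset.sum_mul]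
  refine Finset.sum_congr rfl fun k _ => ?_
  rw [hinl, hinr]
  ring

variable {Ω 𝓧 : Type*} {X : ℕ → Ω → 𝓧}
  {g : 𝓧 → EuclideanSpace ℝ (Fin p) → EuclideanSpace ℝ (Fin m)}
  {Θ : Set (EuclideanSpace ℝ (Fin p))}

theorem sampleMean_psi_inl (n : ℕ) (ω : Ω) (θ : EuclideanSpace ℝ (Fin p)) (i : Fin m) :
    sampleMean X (psi g) n ω θ (Sum.inl i) = sampleMean X g n ω θ i := by
  simp [sampleMean, psi]

/-- First-order condition of the sample problem. -/
theorem apply_crossMatrix_sampleMean_eq_zero (hW : Wᵀ = W) {n : ℕ} {ω : Ω}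
    {θ : EuclideanSpace ℝ (Fin p)} (hθ : θ ∈ interior Θ)
    (hsm : ∀ i, ContDiffAt ℝ 2 (g (X i ω)) θ)
    (hmin : IsMinOn (fun θ => quadForm W (sampleMean X g n ω θ)) Θ θ) :
    apply (crossMatrix W (sampleMean X (psi g) n ω θ)) (sampleMean X (psi g) n ω θ) = 0 := by
  have hd : HasFDerivAt (fun θ => sampleMean X g n ω θ)
      ((n : ℝ)⁻¹ • ∑ i ∈ Finset.range n, fderiv ℝ (g (X i ω)) θ) θ :=
    (HasFDerivAt.fun_sum fun i _ =>
      ((hsm i).differentiableAt (by norm_num)).hasFDerivAt).fun_const_smul _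
  refine apply_crossMatrix_self_eq_zero hW hd
    (hmin.isLocalMin (mem_interior_iff_mem_nhds.1 hθ)) (fun i => sampleMean_psi_inl n ω θ i)
    (fun i j => ?_)
  simp [sampleMean, psi, vecG, Matrix.vec, G, jacobian]

end FirstOrderCondition

/-! ### The GMM estimator as an approximate Z-estimator -/

section GMM

variable {Ω 𝓧 : Type*} [MeasurableSpace Ω] [MeasurableSpace 𝓧] {m p : ℕ}
  {P : Measure Ω} {μ : Measure 𝓧}
  {X : ℕ → Ω → 𝓧} {g : 𝓧 → EuclideanSpace ℝ (Fin p) → EuclideanSpace ℝ (Fin m)}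
  {W : Matrix (Fin m) (Fin m) ℝ} {Θ : Set (EuclideanSpace ℝ (Fin p))}
  {θW : EuclideanSpace ℝ (Fin p)}

/-- A(W, θ_W) is the derivative at ψ₀ of the quadratic map h ↦ `apply (crossMatrix W h) h`; its
Kronecker block comes from varying the Jacobian at fixed g(θ_W). -/
theorem apply_A (hW : Wᵀ = W) (hψ : Integrable (fun x => psi g x θW) μ)
    (hg : Integrable (fun x => g x θW) μ) (v : EuclideanSpace ℝ (AugIdx m p)) :
    apply (A g μ W θW) v = apply (crossMatrix W (∫ x, psi g x θW ∂μ)) v +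
      apply (crossMatrix W v) (∫ x, psi g x θW ∂μ) := by
  ext j
  rw [PiLp.add_apply, apply_crossMatrix, apply_crossMatrix]
  have hG (i : Fin m) : (∫ x, psi g x θW ∂μ) (Sum.inr (i, j)) = popG g μ θW i j := by
    rw [integral_coord hψ]; rfl
  have hg' (k : Fin m) : (∫ x, psi g x θW ∂μ) (Sum.inl k) = popMoment g μ θW k := by
    rw [integral_coord hψ, popMoment, integral_coord hg]; rfl
  simp only [hG, hg', apply, A, Matrix.mulVec, dotProduct, Fintype.sum_sum_type,
    Matrix.fromCols_apply_inl, Matrix.fromCols_apply_inr, Matrix.mul_apply,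
    Matrix.transpose_apply, Finset.sum_mul]
  congr 1
  rw [Fintype.sum_prod_type, Finset.sum_comm]
  simp only [Matrix.submatrix_apply, Matrix.kroneckerMap_apply, Matrix.replicateRow_apply, id,
    Matrix.vecMul, dotProduct, Matrix.one_apply]
  -- The factor I_p of the Kronecker product keeps only the parameter index j.
  rw [Finset.sum_eq_single j (fun b _ hb => by simp [hb.symm]) (by simp), Finset.sum_comm]
  refine Finset.sum_congr rfl fun i _ => ?_
  rw [if_pos rfl, mul_one, Finset.sum_mul]
  refine Finset.sum_congr rfl fun k _ => ?_
  have : W k i = W i k := congrFun (congrFun hW i) k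
  rw [this]
  ring

theorem hasFDerivAt_popMoment (hg : IsDominatedOn μ Θ g)
    (hG : IsDominatedOn μ Θ (fun x θ => fderiv ℝ (g x) θ)) (hθ : θW ∈ interior Θ)
    (hg_smooth : ∀ᵐ x ∂μ, ∀ θ ∈ Θ, ContDiffAt ℝ 2 (g x) θ) :
    HasFDerivAt (popMoment g μ) (∫ x, fderiv ℝ (g x) θW ∂μ) θW := by
  obtain ⟨b, hb, hGb⟩ := hG.bound
  have hΘ := mem_interior_iff_mem_nhds.1 hθ
  refine hasFDerivAt_integral_of_dominated_of_fderiv_le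
    (F' := fun θ x => fderiv ℝ (g x) θ) hΘ ?_ (hg.integrable (mem_of_mem_nhds hΘ))
    (hG.aestronglyMeasurable _ (mem_of_mem_nhds hΘ)) hGb hb ?_
  · filter_upwards [hΘ] with θ hθ
    exact hg.aestronglyMeasurable θ hθ
  · filter_upwards [hg_smooth] with x hx θ hθ
    exact ((hx θ hθ).differentiableAt (by norm_num)).hasFDerivAt

/-- Projection of the augmented moments onto the moments. -/
noncomputable def fstL : EuclideanSpace ℝ (AugIdx m p) →L[ℝ] EuclideanSpace ℝ (Fin m) :=
  LinearMap.toContinuousLinearMap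
    { toFun := fun v => WithLp.toLp 2 fun i => v (Sum.inl i)
      map_add' := fun _ _ => rfl
      map_smul' := fun _ _ => rfl }

/-- First-order condition of the population problem. -/
theorem IsPseudoTrueValue.apply_crossMatrix_eq_zero (hW : Wᵀ = W)
    (hθW : IsPseudoTrueValue g μ W Θ θW) (hθ : θW ∈ interior Θ) (hg : IsDominatedOn μ Θ g)
    (hG : IsDominatedOn μ Θ (fun x θ => fderiv ℝ (g x) θ))
    (hψ : IsDominatedOn μ Θ (psi g))
    (hg_smooth : ∀ᵐ x ∂μ, ∀ θ ∈ Θ, ContDiffAt ℝ 2 (g x) θ) :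
    apply (crossMatrix W (∫ x, psi g x θW ∂μ)) (∫ x, psi g x θW ∂μ) = 0 := by
  have hΘ := mem_interior_iff_mem_nhds.1 hθ
  refine apply_crossMatrix_self_eq_zero hW (hasFDerivAt_popMoment hg hG hθ hg_smooth) ?_
    (fun i => ?_) (fun i j => ?_)
  · filter_upwards [hΘ] with θ hθ
    rcases eq_or_ne θ θW with rfl | hne
    · exact le_rfl
    · exact (hθW.2 θ hθ hne).le
  · rw [integral_coord (hψ.integrable hθW.1), popMoment, integral_coord (hg.integrable hθW.1)]
    rfl
  · rw [ContinuousLinearMap.integral_apply (hG.integrable hθW.1),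
      integral_coord (hψ.integrable hθW.1),
      integral_coord ((hG.integrable hθW.1).apply_continuousLinearMap _)]
    rfl

variable [IsProbabilityMeasure P] [IsProbabilityMeasure μ]

/-- The GMM estimator. -/
theorem IsGMMEstimator.isAsympNormal_and_hasInfluenceRepr (hX_law : ∀ i, HasLaw (X i) μ P)
    (hX_indep : iIndepFun X P) (hW : Wᵀ = W) (hΘ : IsCompact Θ)
    (hθW : IsPseudoTrueValue g μ W Θ θW) (hθ : θW ∈ interior Θ)
    (hg_smooth : ∀ᵐ x ∂μ, ∀ θ ∈ Θ, ContDiffAt ℝ 2 (g x) θ) (hg : IsDominatedOn μ Θ g)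
    (hG : IsDominatedOn μ Θ (fun x θ => fderiv ℝ (g x) θ)) (hψ : IsDominatedOn μ Θ (psi g))
    {s : Set (EuclideanSpace ℝ (Fin p))} (hs : IsCompact s) (hsθ : s ∈ 𝓝 θW) (hsΘ : s ⊆ Θ)
    (hD : IsDominatedOn μ s (fun x θ => fderiv ℝ (psi g x) θ))
    (hL2 : MemLp (fun x => psi g x θW) 2 μ)
    (hA : IsUnit (A g μ W θW * Gam g μ θW))
    {est : ℕ → Ω → EuclideanSpace ℝ (Fin p)} (hest : IsGMMEstimator P X g Θ W est) :
    IsAsympNormal P θW est (VM g μ (A g μ W θW) θW) ∧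
      HasInfluenceRepr P X g μ θW (A g μ W θW) est := by
  refine AugmentedGMM.isAsympNormal_and_hasInfluenceRepr hX_law hX_indep hs hsθ
    (hg_smooth.mono fun x hx θ hθ => hx θ (hsΘ hθ)) hD hL2 hA hest.1 hest.2 ?_
  filter_upwards [hψ.ae_tendstoUniformlyOn_mean hX_law hX_indep hΘ,
    ae_comp_of_hasLaw hX_law hg_smooth] with ω hunif hsm ns hns hgood
  replace hgood : ∀ᶠ k in atTop, est (ns k) ω ∈ Θ ∧
      IsMinOn (fun θ => quadForm W (sampleMean X g (ns k) ω θ)) Θ (est (ns k) ω) :=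
    hgood.mono fun k hk => not_not.1 hk
  have hunif' : TendstoUniformlyOn (fun k θ => sampleMean X (psi g) (ns k) ω θ)
      (fun θ => ∫ x, psi g x θ ∂μ) atTop Θ := fun u hu => hns.eventually (hunif u hu)
  have hfst (k : ℕ) (θ : EuclideanSpace ℝ (Fin p)) :
      fstL (sampleMean X (psi g) k ω θ) = sampleMean X g k ω θ := by
    ext i; exact sampleMean_psi_inl k ω θ i
  have hfst' {θ : EuclideanSpace ℝ (Fin p)} (hθ : θ ∈ Θ) :
      fstL (∫ x, psi g x θ ∂μ) = popMoment g μ θ :=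
    (fstL.integral_comp_comm (hψ.integrable hθ)).symm
  have hcont : ContinuousOn (fun θ => ∫ x, psi g x θ ∂μ) Θ := hψ.continuousOn_integral hΘ
  -- The GMM criterion is read off the moment block of ψ, so the uniform law for ψ suffices.
  have hcons : Tendsto (fun k => est (ns k) ω) atTop (𝓝 θW) := by
    refine tendsto_of_le_of_unique_min hΘ hunif' hcont
      (q := fun v => quadForm W (fstL v)) ?_ hθW.1 (fun θ hθ hne => ?_)
      (hgood.mono fun k hk => hk.1) (hgood.mono fun k hk => ?_)
    · simp only [quadForm_eq_inner]
      fun_prop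
    · simp only [hfst' hθ, hfst' hθW.1]
      exact hθW.2 θ hθ hne
    · simp only [hfst]
      exact hk.2 hθW.1
  refine ⟨hcons, ?_⟩
  set ψ₀ := ∫ x, psi g x θW ∂μ with hψ₀
  set a : ℕ → EuclideanSpace ℝ (AugIdx m p) := fun k =>
    sampleMean X (psi g) (ns k) ω (est (ns k) ω) - ψ₀ with ha
  have ha0 : Tendsto a atTop (𝓝 0) := by
    have h1 := hunif'.tendsto_comp (hcont θW hθW.1)
      (tendsto_nhdsWithin_iff.2 ⟨hcons, hgood.mono fun k hk => hk.1⟩)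
    have := h1.sub_const ψ₀
    rwa [sub_self] at this
  have hpop := hθW.apply_crossMatrix_eq_zero hW hθ hg hG hψ hg_smooth
  -- By consistency the minimizer is eventually interior, so the sample first-order condition holds;
  -- subtracting the population one leaves Aa = -b(a, a).
  have hAa : ∀ᶠ k in atTop, - apply (crossMatrix W (a k)) (a k) =
      applyL (A g μ W θW) (a k) := by
    filter_upwards [hgood, hcons.eventually (isOpen_interior.mem_nhds hθ)] with k hk hint
    have hfoc := apply_crossMatrix_sampleMean_eq_zero (X := X) (n := ns k) (ω := ω) hW hint
      (fun i => hsm i _ hk.1) hk.2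
    have hsplit : sampleMean X (psi g) (ns k) ω (est (ns k) ω) = ψ₀ + a k := by
      simp [ha]
    rw [hsplit, apply_crossMatrix_add, hpop, zero_add] at hfoc
    rw [applyL_apply, apply_A hW (hψ.integrable hθW.1) (hg.integrable hθW.1)]
    exact (eq_neg_of_add_eq_zero_left hfoc).symm
  refine Asymptotics.IsLittleO.congr' ?_ hAa EventuallyEq.rfl
  rw [Asymptotics.isLittleO_iff]
  intro c hc
  filter_upwards [(tendsto_norm_crossMatrix (W := W) ha0).eventually (gt_mem_nhds hc)] with k hk
  rw [norm_neg]
  exact (norm_apply_le _ _).trans (mul_le_mul_of_nonneg_right hk.le (norm_nonneg _))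

end GMM

end AugmentedGMM

theorem theorem1 {Ω 𝓧 : Type*} [MeasurableSpace Ω] [MeasurableSpace 𝓧] {m p : ℕ}
    (P : Measure Ω) [IsProbabilityMeasure P] (μ : Measure 𝓧) [IsProbabilityMeasure μ]
    -- i.i.d. observations with law `μ`
    (X : ℕ → Ω → 𝓧) (hX_law : ∀ i, HasLaw (X i) μ P) (hX_indep : iIndepFun X P)
    -- moment functions, weighting matrix, parameter space and pseudo-true value
    (g : 𝓧 → EuclideanSpace ℝ (Fin p) → EuclideanSpace ℝ (Fin m))
    (hg_meas : ∀ θ, Measurable fun x => g x θ)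
    (W : Matrix (Fin m) (Fin m) ℝ) (hW : W.PosDef)
    (Θ : Set (EuclideanSpace ℝ (Fin p))) (hΘ : IsCompact Θ)
    (θW : EuclideanSpace ℝ (Fin p)) (hθW : AugmentedGMM.IsPseudoTrueValue g μ W Θ θW)
    (hθW_int : θW ∈ interior Θ)
    -- smoothness in `θ`
    (hg_smooth : ∀ᵐ x ∂μ, ∀ θ ∈ Θ, ContDiffAt ℝ 2 (g x) θ)
    -- dominance
    (hg_sup : ∫⁻ x, ⨆ θ ∈ Θ, ‖g x θ‖ₑ ∂μ < ⊤)
    (hG_sup : ∫⁻ x, ⨆ θ ∈ Θ, ‖AugmentedGMM.G g x θ‖ₑ ∂μ < ⊤)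
    (hF_sup : ∫⁻ x, ⨆ θ ∈ Θ, ‖AugmentedGMM.F g x θ‖ₑ ∂μ < ⊤)
    -- second moments at the pseudo-true value
    (hg_sq : ∫⁻ x, ‖g x θW‖ₑ ^ 2 ∂μ < ⊤)
    (hG_sq : ∫⁻ x, ‖AugmentedGMM.G g x θW‖ₑ ^ 2 ∂μ < ⊤) :
    -- the augmented Z-estimator, for every `Λ` that identifies `θW`
    (∀ Λ : Matrix (Fin p) (AugmentedGMM.AugIdx m p) ℝ,
      (∀ θ ∈ Θ, θ ≠ θW →
        AugmentedGMM.apply Λ (∫ x, AugmentedGMM.psiTilde g μ θW x θ ∂μ) ≠ 0) →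
      IsUnit (Λ * AugmentedGMM.Gam g μ θW) →
      ∀ est : ℕ → Ω → EuclideanSpace ℝ (Fin p),
        AugmentedGMM.IsZEstimator P X g μ Θ θW Λ est →
        AugmentedGMM.IsAsympNormal P θW est (AugmentedGMM.VM g μ Λ θW) ∧
        AugmentedGMM.HasInfluenceRepr P X g μ θW Λ est) ∧
    -- the GMM estimator has the limit distribution and the influence function of `Λ = A(W, θW)`
    (IsUnit (AugmentedGMM.A g μ W θW * AugmentedGMM.Gam g μ θW) →
      ∀ est : ℕ → Ω → EuclideanSpace ℝ (Fin p),
        AugmentedGMM.IsGMMEstimator P X g Θ W est →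
        AugmentedGMM.IsAsympNormal P θW est
          (AugmentedGMM.VM g μ (AugmentedGMM.A g μ W θW) θW) ∧
        AugmentedGMM.HasInfluenceRepr P X g μ θW (AugmentedGMM.A g μ W θW) est) := by
  have hg := AugmentedGMM.isDominatedOn_g hΘ hg_meas hg_smooth hg_sup
  have hG := AugmentedGMM.isDominatedOn_fderiv_g hΘ hg_meas hg_smooth hG_sup
  have hvec : AugmentedGMM.IsDominatedOn μ Θ (AugmentedGMM.vecG g) :=
    hG.clm_comp AugmentedGMM.vecL
  have hψ := AugmentedGMM.isDominatedOn_psi hg hvec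
  -- A closed ball around θ_W inside the interior of Θ serves as the compact neighbourhood for the
  -- linearization.
  obtain ⟨r, hr, hball⟩ := Metric.nhds_basis_closedBall.mem_iff.1
    (isOpen_interior.mem_nhds hθW_int)
  have hs : IsCompact (Metric.closedBall θW r) := isCompact_closedBall θW r
  have hsθ : Metric.closedBall θW r ∈ 𝓝 θW := Metric.closedBall_mem_nhds θW hr
  have hsΘ : Metric.closedBall θW r ⊆ Θ := hball.trans interior_subset
  have hs_smooth : ∀ᵐ x ∂μ, ∀ θ ∈ Metric.closedBall θW r, ContDiffAt ℝ 2 (g x) θ :=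
    hg_smooth.mono fun x hx θ hθ => hx θ (hsΘ hθ)
  have hD := AugmentedGMM.isDominatedOn_fderiv_psi hs_smooth (hG.mono hsΘ)
    (AugmentedGMM.isDominatedOn_fderiv_vecG hs hball hg_smooth hvec hF_sup)
  have hL2 := AugmentedGMM.memLp_psi hg_meas
    (hg_smooth.mono fun x hx => (hx θW hθW.1).differentiableAt (by norm_num)) hg_sq hG_sq
  refine ⟨fun Λ hid hΛ est hest => ?_, fun hA est hest => ?_⟩
  · exact hest.isAsympNormal_and_hasInfluenceRepr hX_law hX_indep hΘ hθW.1 hψ hs hsθ hs_smooth hD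
      hL2 hid hΛ
  · exact hest.isAsympNormal_and_hasInfluenceRepr hX_law hX_indep hW.isHermitian hΘ hθW hθW_int
      hg_smooth hg hG hψ hs hsθ hsΘ hD hL2 hA
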